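/- Notation. Let $\{e_1,e_2,e_3\}$ be the standard basis of $\mathbb R^3$, $m=e_1$, $m^\perp=e_2$, and let $|\cdot|$ be the Euclidean norm of vectors, matrices (Frobenius) and third order tensors. Let $a,b,n\in\mathbb R^3$, $\lambda\in(0,1)$ and $A,B\in\mathbb R^{3\times3}$ satisfy the crystallographic theory: $|n|=1$, $n\in\mathrm{span}\{e_1,e_2\}$, $n$ is not collinear with $m$, and $$A-B=a\otimes n,\qquad \lambda A+(1-\lambda)B-I=b\otimes m .$$ Put $K=SO(3)A\cup SO(3)B$, $\alpha=\sqrt{1-(n\cdot m)^2}>0$, $n^\perp=-(n\cdot e_2)e_1+(n\cdot e_1)e_2$, and $\nu=\frac{(I+b\otimes m)n^\perp}{|(I+b\otimes m)n^\perp|}$ (with $\nu=0$ if $(I+b\otimes m)n^\perp=0$). For $L,H>0$ let $\Omega_{L,H}$ be the open parallelepiped with one vertex at $0$, of length $L$ along $m$ and with square cross-section of side $H$, whose edges are parallel to $n^\perp$, $e_2$ and $e_3$: $$\Omega_{L,H}=F_\alpha^{-1}\big((0,L)\times(0,H)\times(0,H)\big),\qquad F_\alpha=I+\frac{n\cdot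 m}{n\cdot m^\perp}\,m^\perp\otimes m$$ (so that $F_\alpha=I-\alpha^{-1}(n\cdot m)\,m^\perp\otimes m$ for the orientation $n\cdot m^\perp=-\alpha$). Let $\hat\varphi:\mathbb R^{3\times3}\to\mathbb R$ be a measurable energy density that vanishes on $K$ and satisfies $\hat\varphi(F)\ge\mathrm{dist}^2(F,K)$ for all $F$, and let $\hat\sigma>0$. Let $\mathcal M$ be the set of all $y\in C(\overline\Omega_{L,H},\mathbb R^3)\cap W^{2,1}(\Omega_{L,H},\mathbb R^3)$ with $y(x)=(I+b\otimes m)x$ for all $x\in\overline\Omega_{L,H}$ with $x\cdot m\in\{0,L\}$, and let $$\mathcal E^\star(\hat\sigma,L,H)=\inf_{y\in\mathcal M}\int_{\Omega_{L,H}}\Big(\hat\varphi(\nabla y)+\hat\sigma|\nabla^2y|\Big)\,dx .$$ Theorem. There is a universal constant $c_\star>0$ (independent of $A,B,a,b,n,\lambda,\hat\varphi,\hat\sigma,L,H$) such that, for all data as above, the following hold. (i) The minimum $$c_K=\min_{G\in K}\max\Big\{\alpha\big|\nu\cdot Gn^\perp-|(I+b\otimes m)n^\perp|\big|,\ \big|\nu\cdot(G-I)m^\perp\big|,\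 \big|\nu\cdot(G-I)e_3\big|\Big\}$$ is attained, and $c_K>0$ if and only if $(I+b\otimes m)n^\perp\cdot a\ne0$. (ii) If $(I+b\otimes m)n^\perp\cdot a\neq0$, then with $\bar c_K=\alpha^{10/3}c_K^{4/3}$ and $\hat c_K=\alpha^2c_K^2$, $$\mathcal E^\star(\hat\sigma,L,H)\ \ge\ c_\star H^3\min\Big\{\bar c_K\frac{\hat\sigma^{2/3}L^{1/3}}{H},\ \hat c_K\frac HL,\ \hat c_K\frac LH\Big\}.$$ -/

import Mathlib

open scoped Matrix ContDiff ENNReal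
open MeasureTheory

namespace TwoWell

/-- Vectors of `ℝ³` in the coordinates of the standard basis `e₁ = e 0`, `e₂ = e 1`, `e₃ = e 2`.
Lengths of vectors are always measured by `len` below, never by the sup norm. -/
abbrev Vec := Fin 3 → ℝ

/-- Real `3 × 3` matrices. -/
abbrev Mat := Matrix (Fin 3) (Fin 3) ℝ

/-- Standard basis vectors.  The habit plane normal is `m = e 0`, and `m^⊥ = e 1`. -/
def e (i : Fin 3) : Vec := Pi.single i 1

/-- The Euclidean length of a vector. -/
noncomputable def len (v : Vec) : ℝ := Real.sqrt (v ⬝ᵥ v)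

/-- The Frobenius norm of a matrix. -/
noncomputable def matNorm (M : Mat) : ℝ := Real.sqrt (∑ i, ∑ j, M i j ^ 2)

/-- The Euclidean norm of a third order tensor. -/
noncomputable def tensorNorm (T : Fin 3 → Fin 3 → Fin 3 → ℝ) : ℝ :=
  Real.sqrt (∑ i, ∑ j, ∑ k, T i j k ^ 2)

/-- The macroscopic deformation gradient `I + b ⊗ m`, with `m = e₁`. -/
noncomputable def macro_grad (b : Vec) : Mat := 1 + Matrix.vecMulVec b (e 0)

/-- The two wells `K = SO(3) A ∪ SO(3) B`. -/
def wells (A B : Mat) : Set Mat :=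
  {G | ∃ Q ∈ Matrix.specialOrthogonalGroup (Fin 3) ℝ, G = Q * A ∨ G = Q * B}

/-- The Frobenius distance of a matrix to `K = SO(3) A ∪ SO(3) B`. -/
noncomputable def distWells (A B F : Mat) : ℝ :=
  sInf ((fun G => matNorm (F - G)) '' wells A B)

/-- The crystallographic theory in coordinates with `m = e₁`, `m^⊥ = e₂`: the twin normal `n` is a
unit vector of the plane spanned by `m` and `m^⊥`, not collinear with `m`, the volume fraction
`lam` is in `(0, 1)`, and `A - B = a ⊗ n`, `lam A + (1 - lam) B - I = b ⊗ m`. -/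
structure Crystallography (A B : Mat) (a b n : Vec) (lam : ℝ) : Prop where
  n_unit : len n = 1
  n_plane : n 2 = 0
  n_not_collinear : n 1 ≠ 0
  lam_pos : 0 < lam
  lam_lt_one : lam < 1
  compat_twin : A - B = Matrix.vecMulVec a n
  compat_habit : lam • A + (1 - lam) • B - 1 = Matrix.vecMulVec b (e 0)

/-- `α = √(1 - (n · m)²)`. -/
noncomputable def alpha (n : Vec) : ℝ := Real.sqrt (1 - (n ⬝ᵥ e 0) ^ 2)

/-- `n^⊥ = -(n · e₂) e₁ + (n · e₁) e₂`. -/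
def nPerp (n : Vec) : Vec := -(n ⬝ᵥ e 1) • e 0 + (n ⬝ᵥ e 0) • e 1

/-- `(I + b ⊗ m) n^⊥`. -/
noncomputable def macroPerp (b n : Vec) : Vec := macro_grad b *ᵥ nPerp n

/-- The direction `ν = (I + b ⊗ m) n^⊥ / |(I + b ⊗ m) n^⊥|`
(and `ν = 0` if the numerator vanishes). -/
noncomputable def nu (b n : Vec) : Vec := (len (macroPerp b n))⁻¹ • macroPerp b n

/-- The quantity minimised over `G ∈ K` in the definition of `c_K`. -/
noncomputable def cKFun (b n : Vec) (G : Mat) : ℝ :=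
  max (alpha n * |nu b n ⬝ᵥ (G *ᵥ nPerp n) - len (macroPerp b n)|)
    (max |nu b n ⬝ᵥ ((G - 1) *ᵥ e 1)| |nu b n ⬝ᵥ ((G - 1) *ᵥ e 2)|)

/-- The crystallographic constant `c_K`, the minimum of `cKFun` over the wells. -/
noncomputable def cK (A B : Mat) (b n : Vec) : ℝ := sInf (cKFun b n '' wells A B)

/-- `α^{10/3} c_K^{4/3}`. -/
noncomputable def cKBar (A B : Mat) (b n : Vec) : ℝ :=
  alpha n ^ (10 / 3 : ℝ) * cK A B b n ^ (4 / 3 : ℝ)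

/-- `α² c_K²`. -/
noncomputable def cKHat (A B : Mat) (b n : Vec) : ℝ := alpha n ^ 2 * cK A B b n ^ 2

/-- The simple shear `I - ((n·m) / α) m^⊥ ⊗ m` which maps the reference parallelepiped to a
rectangular prism, with `α = -(n · m^⊥)`; this is the shear of the form `I + t m^⊥ ⊗ m` which
takes `n^⊥` to a multiple of `m`.  Since `|n · m^⊥| = √(1 - (n · m)²)`, this choice of sign is the
orientation `n · m^⊥ < 0`; the formula used here is also right for the other orientation,
because it does not change under `n ↦ -n`. -/
noncomputable def shear (n : Vec) : Mat :=
  1 + ((n ⬝ᵥ e 0) / (n ⬝ᵥ e 1)) • Matrix.vecMulVec (e 1) (e 0)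

/-- The rectangular prism `(0, L) × (0, H) × (0, H)`. -/
def prism (L H : ℝ) : Set Vec :=
  {z | z 0 ∈ Set.Ioo 0 L ∧ z 1 ∈ Set.Ioo 0 H ∧ z 2 ∈ Set.Ioo 0 H}

/-- The reference configuration: the (open) parallelepiped of length `L` along `m` and square
cross-section of side `H`, with edges parallel to `n^⊥`, `e₂` and `e₃`. -/
def refConf (n : Vec) (L H : ℝ) : Set Vec := {x | shear n *ᵥ x ∈ prism L H}

/-- `g` is the weak partial derivative of `f` in direction `e j` on the open set `U`. -/
def IsWeakPartial (U : Set Vec) (j : Fin 3) (f g : Vec → ℝ) : Prop :=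
  ∀ ψ : Vec → ℝ, ContDiff ℝ ∞ ψ → HasCompactSupport ψ → tsupport ψ ⊆ U →
    ∫ x in U, f x * fderiv ℝ ψ x (e j) = - ∫ x in U, g x * ψ x

/-- `y` is in the Sobolev space `W^{2,1}(U, ℝ³)`, with weak gradient `F`, `F i j = ∂_j y_i`, and
weak second gradient `D`, `D i j k = ∂_k ∂_j y_i`. -/
structure IsW21 (U : Set Vec) (y : Vec → Vec) (F : Vec → Mat)
    (D : Vec → Fin 3 → Fin 3 → Fin 3 → ℝ) : Prop where
  integrable_fun : ∀ i, IntegrableOn (fun x => y x i) U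
  integrable_grad : ∀ i j, IntegrableOn (fun x => F x i j) U
  integrable_hess : ∀ i j k, IntegrableOn (fun x => D x i j k) U
  weak_grad : ∀ i j, IsWeakPartial U j (fun x => y x i) (fun x => F x i j)
  weak_hess : ∀ i j k, IsWeakPartial U k (fun x => F x i j) (fun x => D x i j k)

/-- The energy `∫_U φ(∇y) + σ |∇²y|` of `y ∈ W^{2,1}(U, ℝ³)`, in `[0, ∞]`.  The weak derivatives
of `y` are unique up to null sets, so the infimum only selects representatives of them. -/
noncomputable def energy (φ : Mat → ℝ) (σ : ℝ) (U : Set Vec) (y : Vec → Vec) : ℝ≥0∞ :=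
  ⨅ (F : Vec → Mat) (D : Vec → Fin 3 → Fin 3 → Fin 3 → ℝ) (_ : IsW21 U y F D),
    ∫⁻ x in U, ENNReal.ofReal (φ (F x) + σ * tensorNorm (D x))

/-- The admissible deformations: continuous on the closed parallelepiped, in `W^{2,1}`, and equal
to `(I + b ⊗ m) x` on the two faces `x · m = 0` and `x · m = L`. -/
def admissible (b n : Vec) (L H : ℝ) : Set (Vec → Vec) :=
  {y | ContinuousOn y (closure (refConf n L H)) ∧
    (∃ F D, IsW21 (refConf n L H) y F D) ∧
    ∀ x ∈ closure (refConf n L H), (x ⬝ᵥ e 0 = 0 ∨ x ⬝ᵥ e 0 = L) → y x = macro_grad b *ᵥ x}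

/-- The infimum of the energy over the admissible deformations. -/
noncomputable def minEnergy (φ : Mat → ℝ) (σ : ℝ) (b n : Vec) (L H : ℝ) : ℝ≥0∞ :=
  ⨅ y ∈ admissible b n L H, energy φ σ (refConf n L H) y

/-- A two-well energy density: measurable, zero on `K = SO(3) A ∪ SO(3) B`, and bounded from below
by the squared distance to `K`. -/
structure TwoWellDensity (A B : Mat) (φ : Mat → ℝ) : Prop where
  meas : Measurable fun p : Fin 3 → Fin 3 → ℝ => φ (Matrix.of p)
  zero_on_wells : ∀ G ∈ wells A B, φ G = 0
  dist_sq_le : ∀ F, distWells A B F ^ 2 ≤ φ F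

end TwoWell

namespace TwoWell

/-! ### Euclidean lengths -/

/-! Write M = I + b⊗m, N = M n^⊥ and u = ν·(y − Mx). Both A and B differ from M by a multiple of
a⊗n, which kills n^⊥. So every G in K satisfies G n^⊥ = QN for a rotation Q, hence ν·G n^⊥ ≤ |N|,
and the derivative of u along n^⊥ is bounded above by dist(∇y, K). Segments parallel to n^⊥ join the
two faces on which u = 0, so this one-sided bound already controls the derivative in L¹. Poincaré's
inequality then makes u small in L¹, and interpolation between u and ∇²y makes its derivatives along
e₂ and e₃ small.

The constant c_K is exactly the obstruction: near K the three derivatives of u cannot all be small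
(`Crystallography.cK_le_add`). With V = L H² the volume, δ = ∫ dist(∇y, K) and s = ∫ |∇²y|,
integration gives, for every 0 < ε < H, c_K V ≤ 3δ + 2εs + 48Lδ/(εα)
(`Crystallography.cK_mul_volume_le`). An energy E controls δ² ≤ V E and σs ≤ E. Choosing ε of the
order of the smaller of H and σ c_K V / E yields the three terms of the minimum
(`lower_bound_of_interpolation`): σ^{2/3}L^{1/3}/H when the surface energy limits ε, H/L when the
cross-section does, and L/H from the term 3δ.

The minimum c_K is attained because K is compact. If it vanishes, equality in Cauchy–Schwarz forces
QN = N, and the e₂-component then gives ν·a = 0.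

The analytic inequalities are proved on segments for smooth functions, integrated over parallel
slices of a box, and carried to weak derivatives by mollification and Fatou's lemma. -/

lemma dotProduct_self_nonneg (v : Vec) : 0 ≤ v ⬝ᵥ v :=
  Finset.sum_nonneg fun i _ => mul_self_nonneg (v i)

lemma len_nonneg (v : Vec) : 0 ≤ len v := Real.sqrt_nonneg _

lemma len_sq (v : Vec) : len v ^ 2 = v ⬝ᵥ v := Real.sq_sqrt (dotProduct_self_nonneg v)

lemma len_eq_zero {v : Vec} : len v = 0 ↔ v = 0 := by
  rw [← sq_eq_zero_iff, len_sq, dotProduct_self_eq_zero]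

lemma len_e (i : Fin 3) : len (e i) = 1 := by
  simp [len, e]

lemma matNorm_nonneg (M : Mat) : 0 ≤ matNorm M := Real.sqrt_nonneg _

lemma tensorNorm_nonneg (T : Fin 3 → Fin 3 → Fin 3 → ℝ) : 0 ≤ tensorNorm T := Real.sqrt_nonneg _

lemma abs_dotProduct_mulVec_le (v w : Vec) (X : Mat) :
    |v ⬝ᵥ (X *ᵥ w)| ≤ len v * matNorm X * len w := by
  have h := Finset.sum_mul_sq_le_sq_mul_sq (Finset.univ : Finset (Fin 3 × Fin 3))
    (fun p => X p.1 p.2) (fun p => v p.1 * w p.2)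
  have h1 : ∑ p : Fin 3 × Fin 3, X p.1 p.2 * (v p.1 * w p.2) = v ⬝ᵥ (X *ᵥ w) := by
    simp only [Fintype.sum_prod_type, dotProduct, Matrix.mulVec, Finset.mul_sum]
    exact Finset.sum_congr rfl fun i _ => Finset.sum_congr rfl fun j _ => by ring
  have h2 : ∑ p : Fin 3 × Fin 3, X p.1 p.2 ^ 2 = matNorm X ^ 2 := by
    rw [matNorm, Real.sq_sqrt (by positivity), Fintype.sum_prod_type]
  have h3 : ∑ p : Fin 3 × Fin 3, (v p.1 * w p.2) ^ 2 = len v ^ 2 * len w ^ 2 := by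
    simp only [Fintype.sum_prod_type, len_sq, dotProduct, Finset.sum_mul_sum]
    exact Finset.sum_congr rfl fun i _ => Finset.sum_congr rfl fun j _ => by ring
  rw [h1, h2, h3] at h
  refine abs_le_of_sq_le_sq (h.trans_eq (by ring)) ?_
  have := len_nonneg v; have := len_nonneg w; have := matNorm_nonneg X; positivity

lemma abs_sum_mul_le_len_mul_tensorNorm (v : Vec) (T : Fin 3 → Fin 3 → Fin 3 → ℝ) (j k : Fin 3) :
    |∑ i, v i * T i j k| ≤ len v * tensorNorm T := by
  have h := Finset.sum_mul_sq_le_sq_mul_sq Finset.univ v (fun i => T i j k)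
  have h1 : ∑ i, v i ^ 2 = len v ^ 2 := by
    rw [len_sq]; exact Finset.sum_congr rfl fun i _ => by ring
  have h2 : ∑ i, T i j k ^ 2 ≤ tensorNorm T ^ 2 := by
    rw [tensorNorm, Real.sq_sqrt (by positivity)]
    refine Finset.sum_le_sum fun i _ => ?_
    refine (Finset.single_le_sum (f := fun k => T i j k ^ 2) (fun _ _ => sq_nonneg _)
      (Finset.mem_univ k)).trans ?_
    exact Finset.single_le_sum (f := fun j => ∑ k, T i j k ^ 2)
      (fun _ _ => Finset.sum_nonneg fun _ _ => sq_nonneg _) (Finset.mem_univ j)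
  rw [h1] at h
  refine abs_le_of_sq_le_sq (h.trans ?_) (mul_nonneg (len_nonneg v) (tensorNorm_nonneg T))
  rw [mul_pow]
  exact mul_le_mul_of_nonneg_left h2 (sq_nonneg _)

/-! ### The wells -/

lemma isCompact_specialOrthogonalGroup :
    IsCompact (Matrix.specialOrthogonalGroup (Fin 3) ℝ : Set Mat) := by
  have hc : IsClosed (Matrix.specialOrthogonalGroup (Fin 3) ℝ : Set Mat) := by
    have : (Matrix.specialOrthogonalGroup (Fin 3) ℝ : Set Mat)
        = {Q | Q * Qᵀ = 1} ∩ {Q | Q.det = 1} := by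
      ext Q
      simp only [SetLike.mem_coe, Matrix.mem_specialOrthogonalGroup_iff,
        Matrix.mem_orthogonalGroup_iff, Set.mem_inter_iff, Set.mem_ofPred_eq]
    rw [this]
    exact (isClosed_eq (by fun_prop) continuous_const).inter
      (isClosed_eq (by fun_prop) continuous_const)
  refine IsCompact.of_isClosed_subset (isCompact_univ_pi fun _ : Fin 3 =>
    isCompact_univ_pi fun _ : Fin 3 => isCompact_Icc (a := (-1 : ℝ)) (b := 1)) hc ?_
  intro Q hQ i _ j _
  have := entry_norm_bound_of_unitary (𝕜 := ℝ) (Matrix.mem_specialOrthogonalGroup_iff.1 hQ).1 i j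
  rwa [Real.norm_eq_abs, abs_le] at this

lemma isCompact_wells (A B : Mat) : IsCompact (wells A B) := by
  have : wells A B = (fun Q => Q * A) '' (Matrix.specialOrthogonalGroup (Fin 3) ℝ : Set Mat)
      ∪ (fun Q => Q * B) '' (Matrix.specialOrthogonalGroup (Fin 3) ℝ : Set Mat) := by
    ext G
    simp only [wells, Set.mem_ofPred_eq, Set.mem_union, Set.mem_image, SetLike.mem_coe]
    constructor
    · rintro ⟨Q, hQ, rfl | rfl⟩
      exacts [Or.inl ⟨Q, hQ, rfl⟩, Or.inr ⟨Q, hQ, rfl⟩]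
    · rintro (⟨Q, hQ, rfl⟩ | ⟨Q, hQ, rfl⟩)
      exacts [⟨Q, hQ, Or.inl rfl⟩, ⟨Q, hQ, Or.inr rfl⟩]
  rw [this]
  exact (isCompact_specialOrthogonalGroup.image (by fun_prop)).union
    (isCompact_specialOrthogonalGroup.image (by fun_prop))

lemma left_mem_wells (A B : Mat) : A ∈ wells A B := ⟨1, one_mem _, Or.inl (one_mul A).symm⟩

lemma continuous_matNorm : Continuous matNorm := by
  unfold matNorm; fun_prop

lemma continuous_distWells (A B : Mat) : Continuous (distWells A B) := by
  refine (isCompact_wells A B).continuous_sInf (f := fun F G => matNorm (F - G)) ?_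
  exact continuous_matNorm.comp (by fun_prop)

lemma distWells_nonneg (A B F : Mat) : 0 ≤ distWells A B F := by
  refine Real.sInf_nonneg ?_
  rintro _ ⟨G, _, rfl⟩
  exact matNorm_nonneg _

lemma le_distWells {A B F : Mat} {r : ℝ} (h : ∀ G ∈ wells A B, r ≤ matNorm (F - G)) :
    r ≤ distWells A B F := by
  refine le_csInf ⟨_, A, left_mem_wells A B, rfl⟩ ?_
  rintro _ ⟨G, hG, rfl⟩
  exact h G hG

lemma continuous_cKFun (b n : Vec) : Continuous (cKFun b n) := by
  unfold cKFun; fun_prop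

lemma cKFun_nonneg (b n : Vec) (G : Mat) : 0 ≤ cKFun b n G :=
  le_max_of_le_right (le_max_of_le_left (abs_nonneg _))

lemma isLeast_cK (A B : Mat) (b n : Vec) : IsLeast (cKFun b n '' wells A B) (cK A B b n) :=
  ((isCompact_wells A B).image (continuous_cKFun b n)).isLeast_sInf
    ⟨_, A, left_mem_wells A B, rfl⟩

lemma cK_nonneg (A B : Mat) (b n : Vec) : 0 ≤ cK A B b n := by
  obtain ⟨G, -, hG⟩ := (isLeast_cK A B b n).1
  exact hG ▸ cKFun_nonneg b n G

lemma cK_le {A B G : Mat} (b n : Vec) (hG : G ∈ wells A B) : cK A B b n ≤ cKFun b n G :=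
  (isLeast_cK A B b n).2 ⟨G, hG, rfl⟩

/-! ### Consequences of the crystallographic theory -/

lemma nu_dotProduct_macroPerp {b n : Vec} : nu b n ⬝ᵥ macroPerp b n = len (macroPerp b n) := by
  rcases eq_or_ne (len (macroPerp b n)) 0 with h | h
  · simp [nu, h]
  · rw [nu, smul_dotProduct, ← len_sq, smul_eq_mul]; field_simp

lemma len_nu_le (b n : Vec) : len (nu b n) ≤ 1 := by
  have : len (nu b n) ^ 2 ≤ 1 := by
    rw [len_sq, nu, smul_dotProduct, dotProduct_smul, ← len_sq]
    rcases eq_or_ne (len (macroPerp b n)) 0 with h | h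
    · simp [h]
    · apply le_of_eq; simp only [smul_eq_mul]; field_simp
  exact (sq_le_one_iff₀ (len_nonneg _)).1 this

lemma nPerp_apply (n : Vec) : nPerp n = ![-n 1, n 0, 0] := by
  ext i; fin_cases i <;> simp [nPerp, e]

lemma dotProduct_nPerp (n : Vec) : n ⬝ᵥ nPerp n = 0 := by
  simp [nPerp_apply, dotProduct, Fin.sum_univ_three]; ring

variable {A B : Mat} {a b n : Vec} {lam : ℝ}

lemma Crystallography.sq_add_sq (h : Crystallography A B a b n lam) : n 0 ^ 2 + n 1 ^ 2 = 1 := by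
  have := len_sq n
  rw [h.n_unit] at this
  simp only [dotProduct, Fin.sum_univ_three, h.n_plane] at this
  linarith

lemma Crystallography.alpha_eq (h : Crystallography A B a b n lam) : alpha n = |n 1| := by
  rw [alpha, ← Real.sqrt_sq_eq_abs]
  congr 1
  have := h.sq_add_sq
  simp only [e, dotProduct_single, mul_one]
  linarith

lemma Crystallography.alpha_pos (h : Crystallography A B a b n lam) : 0 < alpha n := by
  rw [h.alpha_eq]; exact abs_pos.2 h.n_not_collinear

lemma Crystallography.alpha_le_one (h : Crystallography A B a b n lam) : alpha n ≤ 1 := by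
  rw [h.alpha_eq, abs_le_one_iff_mul_self_le_one]
  nlinarith [h.sq_add_sq, sq_nonneg (n 0)]

lemma Crystallography.len_nPerp (h : Crystallography A B a b n lam) : len (nPerp n) = 1 := by
  rw [len, Real.sqrt_eq_one, nPerp_apply]
  have := h.sq_add_sq
  simp [dotProduct, Fin.sum_univ_three]; linarith

lemma Crystallography.left_eq (h : Crystallography A B a b n lam) :
    A = macro_grad b + (1 - lam) • Matrix.vecMulVec a n := by
  rw [macro_grad, ← h.compat_habit, ← h.compat_twin]
  module

lemma Crystallography.right_eq (h : Crystallography A B a b n lam) :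
    B = macro_grad b + (-lam) • Matrix.vecMulVec a n := by
  rw [macro_grad, ← h.compat_habit, ← h.compat_twin]
  module

/-- Up to rotation the wells are M + (1 − λ) a⊗n and M − λ a⊗n. Only the fact that the coefficient
is nonzero matters afterwards, so both wells are treated at once. -/
lemma Crystallography.exists_of_mem_wells (h : Crystallography A B a b n lam) {G : Mat}
    (hG : G ∈ wells A B) : ∃ Q ∈ Matrix.specialOrthogonalGroup (Fin 3) ℝ, ∃ t : ℝ, t ≠ 0 ∧
      G = Q * (macro_grad b + t • Matrix.vecMulVec a n) := by
  have := h.lam_pos; have := h.lam_lt_one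
  obtain ⟨Q, hQ, rfl | rfl⟩ := hG
  · exact ⟨Q, hQ, 1 - lam, by linarith, by rw [← h.left_eq]⟩
  · exact ⟨Q, hQ, -lam, by linarith, by rw [← h.right_eq]⟩

lemma mulVec_nPerp (t : ℝ) :
    (macro_grad b + t • Matrix.vecMulVec a n) *ᵥ nPerp n = macroPerp b n := by
  rw [Matrix.add_mulVec, Matrix.smul_mulVec, Matrix.vecMulVec_mulVec, dotProduct_nPerp]
  simp [macroPerp]

lemma vecMulVec_mulVec_e (v w : Vec) (i : Fin 3) : Matrix.vecMulVec v w *ᵥ e i = w i • v := by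
  rw [Matrix.vecMulVec_mulVec, e, dotProduct_single, mul_one]; ext; simp [mul_comm]

lemma macro_grad_mulVec_e {i : Fin 3} (hi : i ≠ 0) : macro_grad b *ᵥ e i = e i := by
  rw [macro_grad, Matrix.add_mulVec, Matrix.one_mulVec, vecMulVec_mulVec_e]
  simp [e, hi]

lemma macro_grad_add_mulVec_e (t : ℝ) {i : Fin 3} (hi : i ≠ 0) :
    (macro_grad b + t • Matrix.vecMulVec a n) *ᵥ e i = e i + (t * n i) • a := by
  rw [Matrix.add_mulVec, macro_grad_mulVec_e hi, Matrix.smul_mulVec, vecMulVec_mulVec_e, smul_smul]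

lemma orthogonal_transpose_mul {Q : Mat} (hQ : Q ∈ Matrix.specialOrthogonalGroup (Fin 3) ℝ) :
    Qᵀ * Q = 1 :=
  (Matrix.mem_orthogonalGroup_iff' _ _).1 (Matrix.mem_specialOrthogonalGroup_iff.1 hQ).1

lemma dotProduct_orthogonal {Q : Mat} (hQ : Q ∈ Matrix.specialOrthogonalGroup (Fin 3) ℝ)
    (v w : Vec) : (Q *ᵥ v) ⬝ᵥ (Q *ᵥ w) = v ⬝ᵥ w := by
  rw [Matrix.dotProduct_mulVec, Matrix.vecMul_mulVec, orthogonal_transpose_mul hQ, Matrix.vecMul_one]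

lemma abs_dotProduct_le (v w : Vec) : |v ⬝ᵥ w| ≤ len v * len w := by
  have h := Finset.sum_mul_sq_le_sq_mul_sq Finset.univ v w
  refine abs_le_of_sq_le_sq ?_ (mul_nonneg (len_nonneg v) (len_nonneg w))
  rw [mul_pow, len_sq, len_sq]
  simpa only [dotProduct, sq] using h

/-- G n^⊥ is a rotated copy of N and |ν| ≤ 1. A rotation can make the left side much smaller, so
only this one-sided bound is available along n^⊥. -/
lemma Crystallography.nu_dotProduct_nPerp_le (h : Crystallography A B a b n lam) {G : Mat}
    (hG : G ∈ wells A B) : nu b n ⬝ᵥ (G *ᵥ nPerp n) ≤ len (macroPerp b n) := by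
  obtain ⟨Q, hQ, t, -, rfl⟩ := h.exists_of_mem_wells hG
  rw [← Matrix.mulVec_mulVec, mulVec_nPerp]
  refine (le_abs_self _).trans ((abs_dotProduct_le _ _).trans ?_)
  have : len (Q *ᵥ macroPerp b n) = len (macroPerp b n) := by
    rw [len, dotProduct_orthogonal hQ, len]
  rw [this]
  exact mul_le_of_le_one_left (len_nonneg _) (len_nu_le b n)

/-- The matrix A itself is a minimiser: A n^⊥ = N, and A e₂ − e₂ and A e₃ − e₃ are multiples of a,
which is orthogonal to ν. -/
lemma cK_eq_zero (h : Crystallography A B a b n lam) (h0 : macroPerp b n ⬝ᵥ a = 0) :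
    cK A B b n = 0 := by
  refine le_antisymm ((cK_le b n (left_mem_wells A B)).trans_eq ?_) (cK_nonneg A B b n)
  have hn : nu b n ⬝ᵥ a = 0 := by rw [nu, smul_dotProduct, h0, smul_zero]
  have h1 : nu b n ⬝ᵥ (A *ᵥ nPerp n) = len (macroPerp b n) := by
    rw [h.left_eq, mulVec_nPerp, nu_dotProduct_macroPerp]
  have h2 : ∀ i : Fin 3, i ≠ 0 → nu b n ⬝ᵥ ((A - 1) *ᵥ e i) = 0 := by
    intro i hi
    rw [h.left_eq, Matrix.sub_mulVec, macro_grad_add_mulVec_e _ hi, Matrix.one_mulVec,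
      add_sub_cancel_left, dotProduct_smul, hn, smul_zero]
  rw [cKFun, h1, h2 1 (by decide), h2 2 (by decide)]
  simp

/-- At a minimiser ν·QN = |N|, so Q fixes N and hence ν. Moving Q across the inner product turns the
e₂-component into t (n·e₂)(ν·a), whose first two factors are nonzero. -/
lemma macroPerp_dotProduct_eq_zero (h : Crystallography A B a b n lam) (h0 : cK A B b n = 0) :
    macroPerp b n ⬝ᵥ a = 0 := by
  rcases eq_or_ne (macroPerp b n) 0 with hN | hN
  · rw [hN, zero_dotProduct]
  have hl : 0 < len (macroPerp b n) :=
    lt_of_le_of_ne (len_nonneg _) fun h' => hN (len_eq_zero.1 h'.symm)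
  obtain ⟨G, hG, hG0⟩ := (isLeast_cK A B b n).1
  rw [h0] at hG0
  have e1 : alpha n * |nu b n ⬝ᵥ (G *ᵥ nPerp n) - len (macroPerp b n)| ≤ 0 :=
    (le_max_left _ _).trans_eq hG0
  have e2 : |nu b n ⬝ᵥ ((G - 1) *ᵥ e 1)| ≤ 0 :=
    ((le_max_left _ _).trans (le_max_right _ _)).trans_eq hG0
  have e1' : nu b n ⬝ᵥ (G *ᵥ nPerp n) = len (macroPerp b n) := by
    have := nonpos_of_mul_nonpos_right e1 h.alpha_pos
    linarith [abs_eq_zero.1 (le_antisymm this (abs_nonneg _))]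
  have e2' : nu b n ⬝ᵥ ((G - 1) *ᵥ e 1) = 0 := abs_eq_zero.1 (le_antisymm e2 (abs_nonneg _))
  obtain ⟨Q, hQ, t, ht, rfl⟩ := h.exists_of_mem_wells hG
  rw [← Matrix.mulVec_mulVec, mulVec_nPerp] at e1'
  -- Equality case of Cauchy–Schwarz: |QN − N|² = 2|N|² − 2 N·QN = 0.
  have hQN : Q *ᵥ macroPerp b n = macroPerp b n := by
    have h3 : macroPerp b n ⬝ᵥ (Q *ᵥ macroPerp b n) = macroPerp b n ⬝ᵥ macroPerp b n := by
      rw [nu, smul_dotProduct, smul_eq_mul, inv_mul_eq_iff_eq_mul₀ hl.ne'] at e1'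
      rw [e1', ← len_sq, sq]
    rw [← sub_eq_zero, ← dotProduct_self_eq_zero, sub_dotProduct, dotProduct_sub, dotProduct_sub,
      dotProduct_orthogonal hQ, dotProduct_comm (Q *ᵥ _) (macroPerp b n), h3]
    ring
  have hQn : Q *ᵥ nu b n = nu b n := by rw [nu, Matrix.mulVec_smul, hQN]
  have hkey : nu b n ⬝ᵥ ((Q * (macro_grad b + t • Matrix.vecMulVec a n)) *ᵥ e 1)
      = nu b n ⬝ᵥ e 1 + t * (n 1 * (nu b n ⬝ᵥ a)) := by
    have h4 : (macro_grad b + t • Matrix.vecMulVec a n) *ᵥ e 1 = e 1 + (t * n 1) • a :=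
      macro_grad_add_mulVec_e t (by decide)
    rw [← Matrix.mulVec_mulVec, h4]
    conv_lhs => rw [← hQn]
    rw [dotProduct_orthogonal hQ, dotProduct_add, dotProduct_smul, smul_eq_mul, mul_assoc]
  rw [Matrix.sub_mulVec, Matrix.one_mulVec, dotProduct_sub, hkey, add_sub_cancel_left] at e2'
  have h5 : nu b n ⬝ᵥ a = 0 := by
    simpa [ht, h.n_not_collinear] using e2'
  rw [nu, smul_dotProduct, smul_eq_mul] at h5
  simpa [hl.ne'] using h5

lemma cK_pos_iff (h : Crystallography A B a b n lam) :
    0 < cK A B b n ↔ macroPerp b n ⬝ᵥ a ≠ 0 := by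
  rw [(cK_nonneg A B b n).lt_iff_ne']
  exact not_congr ⟨macroPerp_dotProduct_eq_zero h, cK_eq_zero h⟩

end TwoWell

namespace TwoWell

/-! ### One-dimensional inequalities -/

/-- Compare f' s with the average of f' against the parabola k, which has integral 1 and vanishes at
p and q. The deviation costs the integral of |f''|. In the average, integration by parts has no
boundary term and moves the derivative onto k, where |k'| ≤ 6/(q − p)². -/
lemma abs_deriv_le_integral {f f' f'' : ℝ → ℝ} (hf : ∀ t, HasDerivAt f (f' t) t)
    (hf' : ∀ t, HasDerivAt f' (f'' t) t) (hf'' : Continuous f'') {p q s : ℝ} (hpq : p < q)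
    (hs : s ∈ Set.Icc p q) :
    |f' s| ≤ 6 / (q - p) ^ 2 * (∫ t in p..q, |f t|) + ∫ t in p..q, |f'' t| := by
  have hl : 0 < q - p := sub_pos.2 hpq
  have cf : Continuous f := continuous_iff_continuousAt.2 fun t => (hf t).continuousAt
  have cf' : Continuous f' := continuous_iff_continuousAt.2 fun t => (hf' t).continuousAt
  set k : ℝ → ℝ := fun t => 6 / (q - p) ^ 3 * ((t - p) * (q - t)) with hk
  set k' : ℝ → ℝ := fun t => 6 / (q - p) ^ 3 * (p + q - 2 * t) with hk'
  have dk : ∀ t, HasDerivAt k (k' t) t := by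
    intro t
    have := (((hasDerivAt_id t).sub_const p).mul ((hasDerivAt_id t).const_sub q)).const_mul
      (6 / (q - p) ^ 3)
    refine this.congr_deriv ?_
    simp only [hk', id]; ring
  have ck : Continuous k := by fun_prop
  have ck' : Continuous k' := by fun_prop
  have hk0 : ∀ t ∈ Set.Icc p q, 0 ≤ k t := fun t ht => by
    have := sub_nonneg.2 ht.1; have := sub_nonneg.2 ht.2; positivity
  have hk1 : ∫ t in p..q, k t = 1 := by
    have hd : ∀ t ∈ Set.uIcc p q, HasDerivAt
        (fun t => 6 / (q - p) ^ 3 * ((p + q) * (t ^ 2 / 2) - t ^ 3 / 3 - p * q * t)) (k t) t := by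
      intro t _
      have := (((((hasDerivAt_pow 2 t).div_const 2).const_mul (p + q)).sub
        ((hasDerivAt_pow 3 t).div_const 3)).sub ((hasDerivAt_id t).const_mul (p * q))).const_mul
        (6 / (q - p) ^ 3)
      refine this.congr_deriv ?_
      simp only [hk]; push_cast; ring
    rw [intervalIntegral.integral_eq_sub_of_hasDerivAt hd (ck.intervalIntegrable _ _)]
    field_simp; ring
  have hpart : ∫ t in p..q, k t * f' t = - ∫ t in p..q, k' t * f t := by
    rw [intervalIntegral.integral_mul_deriv_eq_deriv_mul (fun t _ => dk t) (fun t _ => hf t)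
      (ck'.intervalIntegrable _ _) (cf'.intervalIntegrable _ _)]
    simp [hk]
  have hdiff : ∀ t ∈ Set.Icc p q, |f' s - f' t| ≤ ∫ t in p..q, |f'' t| := by
    intro t ht
    rw [← intervalIntegral.integral_eq_sub_of_hasDerivAt (fun x _ => hf' x)
      (hf''.intervalIntegrable t s)]
    rw [← Real.norm_eq_abs]
    refine intervalIntegral.norm_integral_le_integral_norm_uIoc.trans ?_
    simp only [Real.norm_eq_abs]
    rw [intervalIntegral.integral_of_le hpq.le]
    refine setIntegral_mono_set ((hf''.abs).integrableOn_Ioc) (by filter_upwards; simp) ?_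
    exact (Set.Ioc_subset_Ioc (le_min ht.1 hs.1) (max_le ht.2 hs.2)).eventuallyLE
  have hrep : f' s = - (∫ t in p..q, k' t * f t) + ∫ t in p..q, k t * (f' s - f' t) := by
    have : ∫ t in p..q, k t * (f' s - f' t) = f' s - ∫ t in p..q, k t * f' t := by
      simp_rw [mul_sub]
      have i1 : IntervalIntegrable (fun t => k t * f' s) volume p q :=
        (ck.mul continuous_const).intervalIntegrable _ _
      have i2 : IntervalIntegrable (fun t => k t * f' t) volume p q :=
        (ck.mul cf').intervalIntegrable _ _
      rw [intervalIntegral.integral_sub i1 i2, intervalIntegral.integral_mul_const, hk1, one_mul]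
    rw [this, hpart]; ring
  have b1 : |∫ t in p..q, k' t * f t| ≤ 6 / (q - p) ^ 2 * ∫ t in p..q, |f t| := by
    refine (intervalIntegral.abs_integral_le_integral_abs hpq.le).trans ?_
    rw [← intervalIntegral.integral_const_mul]
    refine intervalIntegral.integral_mono_on hpq.le ((ck'.mul cf).abs.intervalIntegrable _ _)
      ((continuous_const.mul cf.abs).intervalIntegrable _ _) fun t ht => ?_
    rw [abs_mul]
    refine mul_le_mul_of_nonneg_right ?_ (abs_nonneg _)
    have h1 : |p + q - 2 * t| ≤ q - p := abs_le.2 ⟨by linarith [ht.2], by linarith [ht.1]⟩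
    rw [hk']
    simp only
    rw [abs_mul, abs_of_nonneg (by positivity : 0 ≤ 6 / (q - p) ^ 3)]
    calc 6 / (q - p) ^ 3 * |p + q - 2 * t| ≤ 6 / (q - p) ^ 3 * (q - p) := by gcongr
      _ = 6 / (q - p) ^ 2 := by field_simp
  have b2 : |∫ t in p..q, k t * (f' s - f' t)| ≤ ∫ t in p..q, |f'' t| := by
    refine (intervalIntegral.abs_integral_le_integral_abs hpq.le).trans ?_
    calc ∫ t in p..q, |k t * (f' s - f' t)| ≤ ∫ t in p..q, k t * (∫ t in p..q, |f'' t|) := by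
          refine intervalIntegral.integral_mono_on hpq.le
            ((ck.mul (continuous_const.sub cf')).abs.intervalIntegrable _ _)
            ((ck.mul continuous_const).intervalIntegrable _ _) fun t ht => ?_
          rw [abs_mul, abs_of_nonneg (hk0 t ht)]
          exact mul_le_mul_of_nonneg_left (hdiff t ht) (hk0 t ht)
      _ = _ := by rw [intervalIntegral.integral_mul_const, hk1, one_mul]
  rw [hrep]
  refine (abs_add_le _ _).trans (add_le_add ?_ b2)
  rwa [abs_neg]

lemma integral_abs_deriv_le {f f' f'' : ℝ → ℝ} (hf : ∀ t, HasDerivAt f (f' t) t)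
    (hf' : ∀ t, HasDerivAt f' (f'' t) t) (hf'' : Continuous f'') {p q : ℝ} (hpq : p < q) :
    ∫ t in p..q, |f' t| ≤ (q - p) * (∫ t in p..q, |f'' t|) + 6 / (q - p) * ∫ t in p..q, |f t| := by
  have cf' : Continuous f' := continuous_iff_continuousAt.2 fun t => (hf' t).continuousAt
  have hl : 0 < q - p := sub_pos.2 hpq
  calc ∫ t in p..q, |f' t|
      ≤ ∫ _ in p..q, (6 / (q - p) ^ 2 * (∫ t in p..q, |f t|) + ∫ t in p..q, |f'' t|) :=
        intervalIntegral.integral_mono_on hpq.le (cf'.abs.intervalIntegrable _ _)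
          (continuous_const.intervalIntegrable _ _)
          fun t ht => abs_deriv_le_integral hf hf' hf'' hpq ht
    _ = _ := by rw [intervalIntegral.integral_const, smul_eq_mul]; field_simp; ring

/-- Interpolation between a function and its second derivative in `L¹` of an interval. -/
lemma integral_abs_deriv_le_interpolation {f f' f'' : ℝ → ℝ} (hf : ∀ t, HasDerivAt f (f' t) t)
    (hf' : ∀ t, HasDerivAt f' (f'' t) t) (hf'' : Continuous f'') {p q ε : ℝ} (hε : 0 < ε)
    (hεpq : ε ≤ q - p) :
    ∫ t in p..q, |f' t| ≤ ε * (∫ t in p..q, |f'' t|) + 12 / ε * ∫ t in p..q, |f t| := by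
  have cf : Continuous f := continuous_iff_continuousAt.2 fun t => (hf t).continuousAt
  have cf' : Continuous f' := continuous_iff_continuousAt.2 fun t => (hf' t).continuousAt
  -- The pieces have length l with ε/2 ≤ l ≤ ε. The lower bound, which needs ε ≤ q − p, turns the
  -- constant 6/l into 12/ε.
  set N := ⌈(q - p) / ε⌉₊ with hN
  have h1 : 1 ≤ (q - p) / ε := (one_le_div hε).2 hεpq
  have hN1 : (q - p) / ε ≤ N := Nat.le_ceil _
  have hN2 : (N : ℝ) < (q - p) / ε + 1 := Nat.ceil_lt_add_one (by positivity)
  have hN0 : (0 : ℝ) < N := by linarith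
  set l := (q - p) / N with hl
  have hl0 : 0 < l := div_pos (by linarith) hN0
  have hlε : l ≤ ε := by
    rw [hl, div_le_iff₀ hN0]; rw [div_le_iff₀ hε] at hN1; linarith
  have hlε2 : ε / 2 ≤ l := by
    rw [hl, le_div_iff₀ hN0]
    have : (N : ℝ) * ε < 2 * (q - p) := by
      have := mul_lt_mul_of_pos_right hN2 hε
      rw [add_mul, div_mul_cancel₀ _ hε.ne'] at this
      linarith
    linarith
  set c : ℕ → ℝ := fun i => p + i * l with hc
  have hc0 : c 0 = p := by simp [hc]
  have hcN : c N = q := by simp [hc, hl]; field_simp; ring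
  have hsum : ∀ g : ℝ → ℝ, Continuous g →
      ∑ i ∈ Finset.range N, ∫ t in c i..c (i + 1), g t = ∫ t in p..q, g t := by
    intro g hg
    rw [intervalIntegral.sum_integral_adjacent_intervals
      (fun i _ => hg.intervalIntegrable _ _), hc0, hcN]
  rw [← hsum _ cf.abs, ← hsum _ cf'.abs, ← hsum _ hf''.abs, Finset.mul_sum, Finset.mul_sum,
    ← Finset.sum_add_distrib]
  refine Finset.sum_le_sum fun i _ => ?_
  have hci : c (i + 1) - c i = l := by simp [hc]; ring
  have hlt : c i < c (i + 1) := by linarith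
  have := integral_abs_deriv_le hf hf' hf'' hlt
  rw [hci] at this
  refine this.trans (add_le_add ?_ ?_)
  · exact mul_le_mul_of_nonneg_right hlε
      (intervalIntegral.integral_nonneg hlt.le fun _ _ => abs_nonneg _)
  · refine mul_le_mul_of_nonneg_right ?_
      (intervalIntegral.integral_nonneg hlt.le fun _ _ => abs_nonneg _)
    calc 6 / l ≤ 6 / (ε / 2) := by gcongr
      _ = 12 / ε := by field_simp; norm_num

/-- Since f' ≤ d and 0 ≤ d, pointwise |f'| ≤ 2d − f', and the integral of f' sees only the end
values. These are allowed to be small instead of zero because mollification destroys exact boundary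
values. -/
lemma integral_abs_deriv_le_of_deriv_le {f f' d : ℝ → ℝ} (hf : ∀ t, HasDerivAt f (f' t) t)
    (cf' : Continuous f') (cd : Continuous d) {p q r : ℝ} (hpq : p ≤ q)
    (hd0 : ∀ t ∈ Set.Icc p q, 0 ≤ d t) (hd : ∀ t ∈ Set.Icc p q, f' t ≤ d t)
    (hp : |f p| ≤ r) (hq : |f q| ≤ r) :
    ∫ t in p..q, |f' t| ≤ 2 * (∫ t in p..q, d t) + 2 * r := by
  calc ∫ t in p..q, |f' t| ≤ ∫ t in p..q, (2 * d t - f' t) := by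
        refine intervalIntegral.integral_mono_on hpq (cf'.abs.intervalIntegrable _ _)
          (((continuous_const.mul cd).sub cf').intervalIntegrable _ _) fun t ht => ?_
        have := hd0 t ht; have := hd t ht
        exact abs_le.2 ⟨by linarith, by linarith⟩
    _ = 2 * (∫ t in p..q, d t) - (f q - f p) := by
        have i1 : IntervalIntegrable (fun t => 2 * d t) volume p q :=
          (continuous_const.mul cd).intervalIntegrable _ _
        rw [intervalIntegral.integral_sub i1
          (cf'.intervalIntegrable _ _), intervalIntegral.integral_const_mul,
          intervalIntegral.integral_eq_sub_of_hasDerivAt (fun x _ => hf x)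
          (cf'.intervalIntegrable _ _)]
    _ ≤ _ := by linarith [(abs_le.1 hp).2, (abs_le.1 hq).1]

lemma integral_abs_le_of_deriv {f f' : ℝ → ℝ} (hf : ∀ t, HasDerivAt f (f' t) t)
    (cf' : Continuous f') {p q r : ℝ} (hpq : p ≤ q) (hp : |f p| ≤ r) :
    ∫ t in p..q, |f t| ≤ (q - p) * (r + ∫ t in p..q, |f' t|) := by
  have cf : Continuous f := continuous_iff_continuousAt.2 fun t => (hf t).continuousAt
  have : ∀ s ∈ Set.Icc p q, |f s| ≤ r + ∫ t in p..q, |f' t| := by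
    intro s hs
    have h1 := intervalIntegral.integral_eq_sub_of_hasDerivAt (fun x _ => hf x)
      (cf'.intervalIntegrable p s)
    have h2 : |∫ t in p..s, f' t| ≤ ∫ t in p..q, |f' t| :=
      (intervalIntegral.abs_integral_le_integral_abs hs.1).trans
        (intervalIntegral.integral_mono_interval le_rfl hs.1 hs.2
          (Filter.Eventually.of_forall fun _ => abs_nonneg _) (cf'.abs.intervalIntegrable _ _))
    have h3 : f s = f p + ∫ t in p..s, f' t := by linarith
    rw [h3]
    exact (abs_add_le _ _).trans (add_le_add hp h2)
  calc ∫ t in p..q, |f t| ≤ ∫ _ in p..q, (r + ∫ t in p..q, |f' t|) :=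
        intervalIntegral.integral_mono_on hpq (cf.abs.intervalIntegrable _ _)
          (continuous_const.intervalIntegrable _ _) this
    _ = _ := by rw [intervalIntegral.integral_const, smul_eq_mul]

/-! ### Slicing a box along a coordinate direction -/

/-- Fubini in the coordinate i. With G the difference of the two integrands, a one-dimensional
inequality on every segment becomes an inequality on the box. -/
lemma setIntegral_Icc_nonneg_of_slices {l u : Vec} {G : Vec → ℝ} (hG : Continuous G) (i : Fin 3)
    (hi : l i ≤ u i)
    (h : ∀ z : Vec, (∀ j, j ≠ i → z j ∈ Set.Icc (l j) (u j)) →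
      0 ≤ ∫ t in (l i)..(u i), G (Function.update z i t)) :
    0 ≤ ∫ z in Set.Icc l u, G z := by
  set E := MeasurableEquiv.piFinSuccAbove (fun _ : Fin 3 => ℝ) i with hEdef
  have hE : MeasurePreserving E volume (volume.prod volume) :=
    volume_preserving_piFinSuccAbove (fun _ : Fin 3 => ℝ) i
  set T : Set (Fin 2 → ℝ) := Set.Icc (fun j => l (i.succAbove j)) (fun j => u (i.succAbove j))
  have hE1 : ∀ z, E z = (z i, fun j => z (i.succAbove j)) := fun z => rfl
  have hpre : Set.Icc l u = E ⁻¹' (Set.Icc (l i) (u i) ×ˢ T) := by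
    ext z
    simp only [T, Set.mem_preimage, Set.mem_prod, hE1, Set.mem_Icc, Pi.le_def,
      Fin.forall_iff_succAbove i]
    tauto
  have hint : IntegrableOn (fun p => G (E.symm p)) (Set.Icc (l i) (u i) ×ˢ T)
      (volume.prod volume) := by
    rw [← hE.integrableOn_comp_preimage E.measurableEmbedding, ← hpre]
    simp only [Function.comp_def, MeasurableEquiv.symm_apply_apply]
    exact hG.continuousOn.integrableOn_compact isCompact_Icc
  have hG2 := hE.setIntegral_preimage_emb E.measurableEmbedding (fun p => G (E.symm p))
    (Set.Icc (l i) (u i) ×ˢ T)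
  simp only [MeasurableEquiv.symm_apply_apply] at hG2
  rw [hpre, hG2, ← Measure.prod_restrict]
  rw [IntegrableOn, ← Measure.prod_restrict] at hint
  rw [integral_prod_symm _ hint]
  refine setIntegral_nonneg measurableSet_Icc fun z' hz' => ?_
  rw [integral_Icc_eq_integral_Ioc, ← intervalIntegral.integral_of_le hi]
  have key : ∀ t, E.symm (t, z') = Function.update (E.symm (0, z')) i t := by
    intro t
    apply E.injective
    rw [MeasurableEquiv.apply_symm_apply, hE1]
    have h0 : (fun j => E.symm ((0 : ℝ), z') (i.succAbove j)) = z' := by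
      have := E.apply_symm_apply ((0 : ℝ), z')
      rw [hE1] at this
      exact (Prod.mk.inj this).2
    simp [h0]
  have hcong : (fun t => G (E.symm (t, z')))
      = fun t => G (Function.update (E.symm (0, z')) i t) := funext fun t => by rw [key t]
  rw [hcong]
  refine h _ fun j hj => ?_
  obtain ⟨k, rfl⟩ := Fin.exists_succAbove_eq hj
  have : E.symm ((0 : ℝ), z') (i.succAbove k) = z' k := by
    have := E.apply_symm_apply ((0 : ℝ), z')
    rw [hE1] at this
    exact congrFun (Prod.mk.inj this).2 k
  rw [this]
  exact ⟨hz'.1 k, hz'.2 k⟩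

end TwoWell

namespace TwoWell

/-! ### Mollification -/

open scoped Convolution in
/-- The convolution of a mollifier with a function on `U`, extended by zero. -/
noncomputable def mollify (ρ : ContDiffBump (0 : Vec)) (U : Set Vec) (f : Vec → ℝ) : Vec → ℝ :=
  ρ.normed volume ⋆[ContinuousLinearMap.lsmul ℝ ℝ, volume] U.indicator f

variable {ρ : ContDiffBump (0 : Vec)} {U : Set Vec} {f g : Vec → ℝ}

lemma mollify_apply (hU : MeasurableSet U) (z : Vec) :
    mollify ρ U f z = ∫ x in U, ρ.normed volume (z - x) * f x := by
  rw [mollify, convolution_lsmul_swap, ← integral_indicator hU]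
  congr 1; ext x
  by_cases hx : x ∈ U <;> simp [hx]

lemma integrableOn_normed_mul (hf : IntegrableOn f U) (z : Vec) :
    IntegrableOn (fun x => ρ.normed volume (z - x) * f x) U := by
  obtain ⟨C, hC⟩ := (ρ.continuous_normed (μ := volume)).bounded_above_of_compact_support
    ρ.hasCompactSupport_normed
  refine Integrable.bdd_mul (c := C) hf ?_ ?_
  · exact (ρ.continuous_normed.comp (continuous_const.sub continuous_id)).aestronglyMeasurable
  · exact Filter.Eventually.of_forall fun x => hC _

lemma contDiff_mollify (hU : MeasurableSet U) (hf : IntegrableOn f U) :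
    ContDiff ℝ ∞ (mollify ρ U f) :=
  ρ.hasCompactSupport_normed.contDiff_convolution_left _ ρ.contDiff_normed
    (hf.integrable_indicator hU).locallyIntegrable

lemma mollify_mono (hU : MeasurableSet U) (hf : IntegrableOn f U) (hg : IntegrableOn g U)
    (h : ∀ᵐ x ∂volume.restrict U, f x ≤ g x) (z : Vec) : mollify ρ U f z ≤ mollify ρ U g z := by
  rw [mollify_apply hU, mollify_apply hU]
  refine integral_mono_ae (integrableOn_normed_mul hf z) (integrableOn_normed_mul hg z) ?_
  filter_upwards [h] with x hx
  exact mul_le_mul_of_nonneg_left hx (ρ.nonneg_normed _)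

lemma mollify_nonneg (hU : MeasurableSet U) (h : ∀ᵐ x ∂volume.restrict U, 0 ≤ f x) (z : Vec) :
    0 ≤ mollify ρ U f z := by
  rw [mollify_apply hU]
  refine integral_nonneg_of_ae ?_
  filter_upwards [h] with x hx
  exact mul_nonneg (ρ.nonneg_normed _) hx

lemma abs_mollify_le (hU : MeasurableSet U) (z : Vec) :
    |mollify ρ U f z| ≤ mollify ρ U (fun x => |f x|) z := by
  rw [mollify_apply hU, mollify_apply hU]
  refine abs_integral_le_integral_abs.trans_eq ?_
  congr 1; ext x
  rw [abs_mul, abs_of_nonneg (ρ.nonneg_normed _)]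

lemma integrable_mollify (hU : MeasurableSet U) (hf : IntegrableOn f U) :
    Integrable (mollify ρ U f) :=
  ρ.integrable_normed.integrable_convolution _ (hf.integrable_indicator hU)

lemma integral_mollify (hU : MeasurableSet U) (hf : IntegrableOn f U) :
    ∫ z, mollify ρ U f z = ∫ x in U, f x := by
  rw [mollify, integral_convolution _ ρ.integrable_normed (hf.integrable_indicator hU),
    ρ.integral_normed, integral_indicator hU]
  simp

lemma setIntegral_mollify_le (hU : MeasurableSet U) (hf : IntegrableOn f U)
    (h : ∀ᵐ x ∂volume.restrict U, 0 ≤ f x) (S : Set Vec) :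
    ∫ z in S, mollify ρ U f z ≤ ∫ x in U, f x := by
  rw [← integral_mollify (ρ := ρ) hU hf]
  exact setIntegral_le_integral (integrable_mollify hU hf)
    (Filter.Eventually.of_forall (mollify_nonneg hU h))

lemma setIntegral_abs_mollify_le (hU : MeasurableSet U) (hf : IntegrableOn f U) (S : Set Vec) :
    ∫ z in S, |mollify ρ U f z| ≤ ∫ x in U, |f x| :=
  (setIntegral_mono (integrable_mollify hU hf).abs.integrableOn
    (integrable_mollify hU hf.abs).integrableOn (abs_mollify_le hU)).trans
    (setIntegral_mollify_le hU hf.abs (Filter.Eventually.of_forall fun _ => abs_nonneg _) S)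

lemma abs_mollify_le_of_forall_ball (hU : MeasurableSet U) (hf : IntegrableOn f U) {z : Vec}
    {r : ℝ} (hr : 0 ≤ r) (h : ∀ x ∈ Metric.ball z ρ.rOut, x ∈ U → |f x| ≤ r) :
    |mollify ρ U f z| ≤ r := by
  have := dist_convolution_le (μ := volume) (x₀ := z) (z₀ := (0 : ℝ)) hr
    ρ.support_normed_eq.subset ρ.nonneg_normed ρ.integral_normed
    (hf.integrable_indicator hU).aestronglyMeasurable (fun x hx => by
      by_cases hxU : x ∈ U
      · simpa [hxU] using h x hx hxU
      · simpa [hxU] using hr)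
  simpa [mollify] using this

/-- The translate x ↦ ρ(z − x) is an admissible test function because its support lies in the ball
around z. The sign from its chain rule cancels the one in the definition of a weak derivative. -/
lemma fderiv_mollify (hU : MeasurableSet U) (hf : IntegrableOn f U) {j : Fin 3}
    (hfg : IsWeakPartial U j f g) {z : Vec} (hz : Metric.closedBall z ρ.rOut ⊆ U) :
    fderiv ℝ (mollify ρ U f) z (e j) = mollify ρ U g z := by
  have hli := (hf.integrable_indicator hU).locallyIntegrable
  have hρ : ContDiff ℝ ∞ (ρ.normed volume) := ρ.contDiff_normed
  have hd := (ρ.hasCompactSupport_normed (μ := volume)).hasFDerivAt_convolution_left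
    (ContinuousLinearMap.lsmul ℝ ℝ) (ρ.contDiff_normed (n := 1)) hli z
  have hex := ((ρ.hasCompactSupport_normed (μ := volume)).fderiv (𝕜 := ℝ)).convolutionExists_left
    ((ContinuousLinearMap.lsmul ℝ ℝ : ℝ →L[ℝ] ℝ →L[ℝ] ℝ).precompL Vec)
    (hρ.continuous_fderiv (by simp)) hli z
  rw [mollify, hd.fderiv, convolution_eq_swap _]
  have hψ : ContDiff ℝ ∞ (fun x => ρ.normed volume (z - x)) :=
    hρ.comp (contDiff_const.sub contDiff_id)
  have hsupp : tsupport (fun x => ρ.normed volume (z - x)) ⊆ Metric.closedBall z ρ.rOut := by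
    refine closure_minimal ?_ Metric.isClosed_closedBall
    intro x hx
    have : z - x ∈ Function.support (ρ.normed volume) := hx
    rw [ρ.support_normed_eq, Metric.mem_ball, dist_zero_right] at this
    rw [Metric.mem_closedBall, dist_comm, dist_eq_norm]
    exact this.le
  have hcs : HasCompactSupport (fun x => ρ.normed volume (z - x)) :=
    (isCompact_closedBall z ρ.rOut).of_isClosed_subset (isClosed_tsupport _) hsupp
  have key := hfg _ hψ hcs (hsupp.trans hz)
  have hder : ∀ x, fderiv ℝ (fun x => ρ.normed volume (z - x)) x (e j)
      = - fderiv ℝ (ρ.normed volume) (z - x) (e j) := by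
    intro x
    have h1 : HasFDerivAt (ρ.normed volume) (fderiv ℝ (ρ.normed volume) (z - x)) (z - x) :=
      (hρ.differentiable (by simp) _).hasFDerivAt
    have h2 : HasFDerivAt (fun x => ρ.normed volume (z - x)) _ x := h1.comp x ((hasFDerivAt_id x).const_sub z)
    rw [h2.fderiv]; simp
  simp only [hder, mul_neg, integral_neg, neg_inj] at key
  rw [mollify_apply hU, ContinuousLinearMap.integral_apply]
  · rw [← integral_indicator hU] at key
    simp only [mul_comm (g _)] at key
    rw [← key]
    congr 1; ext x
    by_cases hx : x ∈ U <;> simp [hx, mul_comm]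
  · exact (convolutionExistsAt_flip.1 hex)

end TwoWell

namespace TwoWell

/-! ### Inequalities in a box -/

/-- The open box with corners `0` and `S`. -/
def box (S : Vec) : Set Vec := {z | ∀ i, z i ∈ Set.Ioo 0 (S i)}

/-- A sequence of mollifiers. -/
noncomputable def bumpSeq (k : ℕ) : ContDiffBump (0 : Vec) where
  rIn := ((k : ℝ) + 1)⁻¹
  -- The bounded ratio of outer to inner radius is what almost everywhere convergence at Lebesgue
  -- points requires.
  rOut := 2 * ((k : ℝ) + 1)⁻¹
  rIn_pos := by positivity
  rIn_lt_rOut := by have : 0 < ((k : ℝ) + 1)⁻¹ := by positivity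
                    linarith

/-- The box `box S`, shrunk by twice the radius of the mollifier. -/
noncomputable def innerBox (S : Vec) (k : ℕ) : Set Vec :=
  Set.Icc (fun _ => 2 * (bumpSeq k).rOut) (fun i => S i - 2 * (bumpSeq k).rOut)

variable {S : Vec} {f g h : Vec → ℝ} {i : Fin 3} {k : ℕ}

lemma box_eq_pi (S : Vec) : box S = Set.univ.pi fun i => Set.Ioo 0 (S i) := by
  ext; simp [box]

lemma isOpen_box (S : Vec) : IsOpen (box S) := by
  rw [box_eq_pi]; exact isOpen_set_pi Set.finite_univ fun _ _ => isOpen_Ioo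

lemma measurableSet_box (S : Vec) : MeasurableSet (box S) := (isOpen_box S).measurableSet

lemma volume_box_ne_top (S : Vec) : volume (box S) ≠ ⊤ := by
  rw [box_eq_pi]
  refine ((measure_mono (Set.pi_mono fun i _ => Set.Ioo_subset_Icc_self)).trans_lt ?_).ne
  exact (isCompact_univ_pi fun _ => isCompact_Icc).measure_lt_top

lemma tendsto_rOut_bumpSeq :
    Filter.Tendsto (fun k => (bumpSeq k).rOut) Filter.atTop (nhds 0) := by
  have := (tendsto_one_div_add_atTop_nhds_zero_nat (𝕜 := ℝ)).const_mul 2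
  simpa [bumpSeq] using this

lemma eventually_rOut_lt {r : ℝ} (hr : 0 < r) : ∀ᶠ k in Filter.atTop, (bumpSeq k).rOut < r :=
  tendsto_rOut_bumpSeq.eventually (gt_mem_nhds hr)

lemma closedBall_subset_box {r : ℝ} {z : Vec} (hz : ∀ i, r < z i ∧ z i < S i - r) :
    Metric.closedBall z r ⊆ box S := by
  intro x hx i
  have h1 : |x i - z i| ≤ r := (dist_le_pi_dist x z i).trans hx
  have := hz i
  rw [abs_le] at h1
  exact ⟨by linarith, by linarith⟩

lemma innerBox_subset_box (S : Vec) (k : ℕ) : innerBox S k ⊆ box S := fun z hz i => by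
  have h1 := hz.1 i; have h2 := hz.2 i; have := (bumpSeq k).rOut_pos
  simp only at h1 h2
  exact ⟨by linarith, by linarith⟩

/-- One radius of the margin lets the mollifier fit into the box, the other leaves a whole
neighbourhood of z on which the identity holds. It can therefore be differentiated once more, which
gives second derivatives. -/
lemma fderiv_mollify_eventuallyEq (hf : IntegrableOn f (box S))
    (hfg : IsWeakPartial (box S) i f g) {z : Vec} (hz : z ∈ innerBox S k) :
    (fun x => fderiv ℝ (mollify (bumpSeq k) (box S) f) x (e i))
      =ᶠ[nhds z] mollify (bumpSeq k) (box S) g := by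
  have hr := (bumpSeq k).rOut_pos
  have hnear : Metric.ball z (bumpSeq k).rOut ∈ nhds z := Metric.ball_mem_nhds z hr
  filter_upwards [hnear] with x hx
  refine fderiv_mollify (measurableSet_box S) hf hfg (closedBall_subset_box fun j => ?_)
  have h1 : |x j - z j| < (bumpSeq k).rOut := (dist_le_pi_dist x z j).trans_lt hx
  have h2 := hz.1 j; have h3 := hz.2 j
  simp only at h2 h3
  rw [abs_lt] at h1
  exact ⟨by linarith, by linarith⟩

lemma eventually_mem_innerBox {z : Vec} (hz : z ∈ box S) :
    ∀ᶠ k in Filter.atTop, z ∈ innerBox S k := by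
  have : ∀ j, ∀ᶠ k in Filter.atTop, 2 * (bumpSeq k).rOut ≤ z j ∧
      z j ≤ S j - 2 * (bumpSeq k).rOut := by
    intro j
    filter_upwards [eventually_rOut_lt (half_pos (hz j).1),
      eventually_rOut_lt (half_pos (sub_pos.2 (hz j).2))] with k h1 h2
    exact ⟨by linarith, by linarith⟩
  filter_upwards [Filter.eventually_all.2 this] with k hk
  exact ⟨fun j => (hk j).1, fun j => (hk j).2⟩

/-- Mollifications converge almost everywhere and every point of the box eventually lies in the
inner boxes, so Fatou's lemma applies. The slack r absorbs the errors in the boundary values. -/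
lemma integral_abs_le_of_mollify (hf : IntegrableOn f (box S)) {C : ℝ}
    (hC : ∀ r > 0, ∀ᶠ k in Filter.atTop,
      ∫ z in innerBox S k, (|mollify (bumpSeq k) (box S) f z| - r) ≤ C) :
    ∫ z in box S, |f z| ≤ C := by
  have hm := measurableSet_box S
  set V := volume.real (box S)
  have hV : 0 ≤ V := measureReal_nonneg
  have hcont : ∀ k, Continuous (mollify (bumpSeq k) (box S) f) := fun k =>
    (contDiff_mollify hm hf).continuous
  have hle : ∀ r > 0, ∫ z in box S, |f z| ≤ C + r * V := by
    intro r hr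
    have hev : ∀ᶠ k in Filter.atTop,
        ∫ z in innerBox S k, |mollify (bumpSeq k) (box S) f z| ≤ C + r * V := by
      filter_upwards [hC r hr] with k hk
      have hi1 : IntegrableOn (fun z => |mollify (bumpSeq k) (box S) f z|) (innerBox S k) :=
        (hcont k).abs.continuousOn.integrableOn_compact isCompact_Icc
      have hi2 : IntegrableOn (fun _ : Vec => r) (innerBox S k) :=
        continuousOn_const.integrableOn_compact isCompact_Icc
      rw [integral_sub hi1 hi2, setIntegral_const, smul_eq_mul] at hk
      have : volume.real (innerBox S k) ≤ V :=
        measureReal_mono (innerBox_subset_box S k) (volume_box_ne_top S)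
      have := mul_le_mul_of_nonneg_right this hr.le
      linarith
    have hC0 : 0 ≤ C + r * V := by
      obtain ⟨k, hk⟩ := hev.exists
      exact (integral_nonneg fun _ => abs_nonneg _).trans hk
    set Φ : ℕ → Vec → ℝ≥0∞ := fun k =>
      (innerBox S k).indicator fun z => ENNReal.ofReal |mollify (bumpSeq k) (box S) f z| with hΦ
    have hΦm : ∀ k, Measurable (Φ k) := fun k =>
      ((hcont k).abs.measurable.ennreal_ofReal).indicator measurableSet_Icc
    have hlim : ∀ᵐ z ∂volume.restrict (box S),
        ENNReal.ofReal |f z| = Filter.liminf (fun k => Φ k z) Filter.atTop := by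
      have hae := ContDiffBump.ae_convolution_tendsto_right_of_locallyIntegrable (K := 2)
        (μ := volume) tendsto_rOut_bumpSeq (Filter.Eventually.of_forall fun k => le_rfl)
        (hf.integrable_indicator hm).locallyIntegrable
      filter_upwards [ae_restrict_of_ae hae, ae_restrict_mem hm] with z hz hzb
      rw [Set.indicator_of_mem hzb] at hz
      refine (Filter.Tendsto.liminf_eq ?_).symm
      have h1 : Filter.Tendsto (fun k => ENNReal.ofReal |mollify (bumpSeq k) (box S) f z|)
          Filter.atTop (nhds (ENNReal.ofReal |f z|)) := ENNReal.tendsto_ofReal hz.abs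
      refine h1.congr' ?_
      filter_upwards [eventually_mem_innerBox hzb] with k hk
      simp only [hΦ, Set.indicator_of_mem hk]
    have hfin : ∫⁻ z in box S, ENNReal.ofReal |f z| ≤ ENNReal.ofReal (C + r * V) := by
      rw [lintegral_congr_ae hlim]
      refine (lintegral_liminf_le hΦm).trans ?_
      refine Filter.liminf_le_of_frequently_le' (Filter.Eventually.frequently ?_)
      filter_upwards [hev] with k hk
      have hmI : MeasurableSet (innerBox S k) := measurableSet_Icc
      simp only [hΦ]
      rw [lintegral_indicator hmI, Measure.restrict_restrict hmI,
        Set.inter_eq_left.2 (innerBox_subset_box S k), ← ofReal_integral_eq_lintegral_ofReal]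
      · exact ENNReal.ofReal_le_ofReal hk
      · exact (hcont k).abs.continuousOn.integrableOn_compact isCompact_Icc
      · exact Filter.Eventually.of_forall fun _ => abs_nonneg _
    rw [← ofReal_integral_eq_lintegral_ofReal hf.abs
      (Filter.Eventually.of_forall fun _ => abs_nonneg _)] at hfin
    exact (ENNReal.ofReal_le_ofReal_iff hC0).1 hfin
  -- The denominator V + 1 avoids a separate case for a box of volume zero.
  refine le_of_forall_pos_le_add fun ε hε => (hle (ε / (V + 1)) (by positivity)).trans ?_
  have : ε / (V + 1) * V ≤ ε := by
    rw [div_mul_eq_mul_div, div_le_iff₀ (by positivity)]; nlinarith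
  linarith

lemma hasDerivAt_comp_update {f : Vec → ℝ} (hf : ContDiff ℝ ∞ f) (z : Vec) (i : Fin 3) (t : ℝ) :
    HasDerivAt (fun t => f (Function.update z i t)) (fderiv ℝ f (Function.update z i t) (e i)) t :=
  (hf.differentiable (by simp) _).hasFDerivAt.comp_hasDerivAt t (hasDerivAt_update z i t)

lemma contDiff_fderiv_apply {f : Vec → ℝ} (hf : ContDiff ℝ ∞ f) (v : Vec) :
    ContDiff ℝ ∞ (fun x => fderiv ℝ f x v) :=
  (hf.fderiv_right (m := ∞) (by simp)).clm_apply contDiff_const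

lemma setIntegral_innerBox_nonneg {G : Vec → ℝ} (hG : Continuous G) (i : Fin 3)
    (hk : 4 * (bumpSeq k).rOut ≤ S i)
    (h : ∀ z : Vec, (∀ t ∈ Set.Icc (2 * (bumpSeq k).rOut) (S i - 2 * (bumpSeq k).rOut),
        Function.update z i t ∈ innerBox S k) →
      0 ≤ ∫ t in (2 * (bumpSeq k).rOut)..(S i - 2 * (bumpSeq k).rOut), G (Function.update z i t)) :
    0 ≤ ∫ z in innerBox S k, G z := by
  refine setIntegral_Icc_nonneg_of_slices hG i (by linarith) fun z hz => h z fun t ht => ?_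
  constructor <;> intro j <;> rcases eq_or_ne j i with rfl | hj
  · simpa using ht.1
  · simpa [hj] using (hz j hj).1
  · simpa using ht.2
  · simpa [hj] using (hz j hj).2

lemma box_interpolation (hf : IntegrableOn f (box S)) (hg : IntegrableOn g (box S))
    (hh : IntegrableOn h (box S)) (hfg : IsWeakPartial (box S) i f g)
    (hgh : IsWeakPartial (box S) i g h) {ε : ℝ} (hε : 0 < ε) (hεS : ε < S i) :
    ∫ z in box S, |g z| ≤ ε * (∫ z in box S, |h z|) + 12 / ε * ∫ z in box S, |f z| := by
  have hm := measurableSet_box S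
  refine integral_abs_le_of_mollify hg fun r hr => ?_
  -- After losing four radii the edge still has length at least ε; this is where ε < S i is needed
  -- strictly.
  filter_upwards [eventually_rOut_lt (r := (S i - ε) / 4) (by linarith)] with k hk
  have hk4 : ε ≤ S i - 2 * (bumpSeq k).rOut - 2 * (bumpSeq k).rOut := by linarith
  set F := mollify (bumpSeq k) (box S) f with hF
  have cF : ContDiff ℝ ∞ F := contDiff_mollify hm hf
  set F1 : Vec → ℝ := fun x => fderiv ℝ F x (e i) with hF1
  have cF1 : ContDiff ℝ ∞ F1 := contDiff_fderiv_apply cF _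
  set F2 : Vec → ℝ := fun x => fderiv ℝ F1 x (e i) with hF2
  have cF2 : ContDiff ℝ ∞ F2 := contDiff_fderiv_apply cF1 _
  have e1 : ∀ z ∈ innerBox S k, F1 z = mollify (bumpSeq k) (box S) g z := fun z hz =>
    (fderiv_mollify_eventuallyEq hf hfg hz).eq_of_nhds
  have e2 : ∀ z ∈ innerBox S k, F2 z = mollify (bumpSeq k) (box S) h z := fun z hz => by
    have h1 : F1 =ᶠ[nhds z] mollify (bumpSeq k) (box S) g := fderiv_mollify_eventuallyEq hf hfg hz
    rw [hF2]
    simp only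
    rw [h1.fderiv_eq]
    exact (fderiv_mollify_eventuallyEq hg hgh hz).eq_of_nhds
  have hint : ∀ {G : Vec → ℝ}, Continuous G → IntegrableOn G (innerBox S k) := fun hG =>
    hG.continuousOn.integrableOn_compact isCompact_Icc
  have hslice := setIntegral_innerBox_nonneg (S := S) (k := k)
    (G := fun z => (ε * |F2 z| + 12 / ε * |F z|) - |F1 z|)
    (((continuous_const.mul cF2.continuous.abs).add
      (continuous_const.mul cF.continuous.abs)).sub cF1.continuous.abs) i (by linarith)
    (fun z _ => by
      have cu : Continuous fun t => Function.update z i t := continuous_const.update i continuous_id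
      have := integral_abs_deriv_le_interpolation (fun t => hasDerivAt_comp_update cF z i t)
        (fun t => hasDerivAt_comp_update cF1 z i t) (cF2.continuous.comp cu) hε hk4
      have i2 := ((cF2.continuous.comp cu).abs.const_mul ε).intervalIntegrable (μ := volume)
        (2 * (bumpSeq k).rOut) (S i - 2 * (bumpSeq k).rOut)
      have i0 := ((cF.continuous.comp cu).abs.const_mul (12 / ε)).intervalIntegrable (μ := volume)
        (2 * (bumpSeq k).rOut) (S i - 2 * (bumpSeq k).rOut)
      have i1 := (cF1.continuous.comp cu).abs.intervalIntegrable (μ := volume)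
        (2 * (bumpSeq k).rOut) (S i - 2 * (bumpSeq k).rOut)
      simp only [Function.comp_def] at i0 i1 i2
      rw [intervalIntegral.integral_sub (i2.add i0) i1, intervalIntegral.integral_add i2 i0,
        intervalIntegral.integral_const_mul, intervalIntegral.integral_const_mul]
      exact sub_nonneg.2 this)
  have j2 := (hint cF2.continuous.abs).const_mul ε
  have j0 := (hint cF.continuous.abs).const_mul (12 / ε)
  have j1 := hint cF1.continuous.abs
  have j20 : IntegrableOn (fun z => ε * |F2 z| + 12 / ε * |F z|) (innerBox S k) := j2.add j0
  rw [integral_sub j20 j1, integral_add j2 j0, integral_const_mul, integral_const_mul]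
    at hslice
  have b2 : ∫ z in innerBox S k, |F2 z| ≤ ∫ z in box S, |h z| := by
    refine (setIntegral_congr_fun measurableSet_Icc fun z hz => ?_).trans_le
      (setIntegral_abs_mollify_le (ρ := bumpSeq k) hm hh _)
    simp only [e2 z hz]
  have b0 : ∫ z in innerBox S k, |F z| ≤ ∫ z in box S, |f z| := setIntegral_abs_mollify_le hm hf _
  have b1 : ∫ z in innerBox S k, (|mollify (bumpSeq k) (box S) g z| - r)
      ≤ ∫ z in innerBox S k, |F1 z| := by
    refine setIntegral_mono_on ((hint (contDiff_mollify hm hg).continuous.abs).sub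
      (hint continuous_const)) j1 measurableSet_Icc fun z hz => ?_
    rw [e1 z hz]; linarith
  have b2' := mul_le_mul_of_nonneg_left b2 hε.le
  have b0' := mul_le_mul_of_nonneg_left b0 (by positivity : 0 ≤ 12 / ε)
  linarith

/-- On an end face of the inner box the mollifier sees only points within three radii of a face
where f = 0. Projecting such a point to that face and using uniform continuity bounds f there. -/
lemma mollify_small_near_faces (hf : IntegrableOn f (box S))
    (hfc : ContinuousOn f (Set.Icc 0 S))
    (hf0 : ∀ z ∈ Set.Icc 0 S, z i = 0 ∨ z i = S i → f z = 0) {r : ℝ} (hr : 0 < r) :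
    ∀ᶠ k in Filter.atTop, ∀ z ∈ innerBox S k,
      z i = 2 * (bumpSeq k).rOut ∨ z i = S i - 2 * (bumpSeq k).rOut →
      |mollify (bumpSeq k) (box S) f z| ≤ r := by
  have huc := isCompact_Icc.uniformContinuousOn_of_continuous hfc
  obtain ⟨δ, hδ, h⟩ := Metric.uniformContinuousOn_iff.1 huc r hr
  filter_upwards [eventually_rOut_lt (r := δ / 3) (by linarith)] with k hk z hz hzi
  have hρ := (bumpSeq k).rOut_pos
  refine abs_mollify_le_of_forall_ball (measurableSet_box S) hf hr.le fun x hx hxb => ?_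
  have hxI : x ∈ Set.Icc 0 S := ⟨fun j => (hxb j).1.le, fun j => (hxb j).2.le⟩
  have hxz : |x i - z i| < (bumpSeq k).rOut := (dist_le_pi_dist x z i).trans_lt hx
  rw [abs_lt] at hxz
  have main : ∀ c, c = 0 ∨ c = S i → |x i - c| < δ → |f x| ≤ r := by
    intro c hc hxc
    have hS : 0 ≤ S i := hxI.1 i |>.trans (hxI.2 i)
    have hyI : Function.update x i c ∈ Set.Icc 0 S := by
      constructor <;> intro j <;> rcases eq_or_ne j i with rfl | hj
      · rcases hc with rfl | rfl <;> simp [hS]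
      · simpa [hj] using hxI.1 j
      · rcases hc with rfl | rfl <;> simp [hS]
      · simpa [hj] using hxI.2 j
    have hd : dist x (Function.update x i c) < δ := by
      refine (dist_pi_lt_iff hδ).2 fun j => ?_
      rcases eq_or_ne j i with rfl | hj
      · simpa [Real.dist_eq] using hxc
      · simpa [hj] using hδ
    have := h x hxI _ hyI hd
    rw [hf0 _ hyI (by simpa using hc), Real.dist_eq, sub_zero] at this
    exact this.le
  rcases hzi with hzi | hzi
  · exact main 0 (Or.inl rfl) (abs_lt.2 ⟨by linarith, by linarith⟩)
  · exact main (S i) (Or.inr rfl) (abs_lt.2 ⟨by linarith, by linarith⟩)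

lemma box_integral_abs_partial_le {d : Vec → ℝ} (hf : IntegrableOn f (box S))
    (hg : IntegrableOn g (box S)) (hd : IntegrableOn d (box S))
    (hfg : IsWeakPartial (box S) i f g) (hS : 0 < S i) (hfc : ContinuousOn f (Set.Icc 0 S))
    (hf0 : ∀ z ∈ Set.Icc 0 S, z i = 0 ∨ z i = S i → f z = 0)
    (hd0 : ∀ᵐ z ∂volume.restrict (box S), 0 ≤ d z)
    (hgd : ∀ᵐ z ∂volume.restrict (box S), g z ≤ d z) :
    ∫ z in box S, |g z| ≤ 2 * ∫ z in box S, d z := by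
  have hm := measurableSet_box S
  refine integral_abs_le_of_mollify hg fun r hr => ?_
  -- The shrunken edge is at least S i / 2 long, so the two end values, together at most S i * r /
  -- 2, are paid for by the slack r.
  filter_upwards [eventually_rOut_lt (r := S i / 8) (by linarith),
    mollify_small_near_faces hf hfc hf0 (r := S i * r / 4) (by positivity)] with k hk hsmall
  have hk4 : 2 * (bumpSeq k).rOut ≤ S i - 2 * (bumpSeq k).rOut := by linarith
  set F := mollify (bumpSeq k) (box S) f with hF
  have cF : ContDiff ℝ ∞ F := contDiff_mollify hm hf
  set F1 : Vec → ℝ := fun x => fderiv ℝ F x (e i) with hF1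
  have cF1 : ContDiff ℝ ∞ F1 := contDiff_fderiv_apply cF _
  set D := mollify (bumpSeq k) (box S) d with hD
  have cD : ContDiff ℝ ∞ D := contDiff_mollify hm hd
  have e1 : ∀ z ∈ innerBox S k, F1 z = mollify (bumpSeq k) (box S) g z := fun z hz =>
    (fderiv_mollify_eventuallyEq hf hfg hz).eq_of_nhds
  have hint : ∀ {G : Vec → ℝ}, Continuous G → IntegrableOn G (innerBox S k) := fun hG =>
    hG.continuousOn.integrableOn_compact isCompact_Icc
  have hslice := setIntegral_innerBox_nonneg (S := S) (k := k)
    (G := fun z => 2 * D z - (|F1 z| - r))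
    ((continuous_const.mul cD.continuous).sub (cF1.continuous.abs.sub continuous_const)) i
    (by linarith)
    (fun z hz => by
      have cu : Continuous fun t => Function.update z i t := continuous_const.update i continuous_id
      have := integral_abs_deriv_le_of_deriv_le (fun t => hasDerivAt_comp_update cF z i t)
        (cF1.continuous.comp cu) (cD.continuous.comp cu) hk4
        (fun t _ => mollify_nonneg hm hd0 _)
        (fun t ht => by
          refine (e1 _ (hz t ht)).trans_le ?_
          exact mollify_mono hm hg hd hgd _)
        (hsmall _ (hz _ (Set.left_mem_Icc.2 hk4)) (by simp))
        (hsmall _ (hz _ (Set.right_mem_Icc.2 hk4)) (by simp))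
      have i2 := ((cD.continuous.comp cu).const_mul 2).intervalIntegrable (μ := volume)
        (2 * (bumpSeq k).rOut) (S i - 2 * (bumpSeq k).rOut)
      have i1 := (cF1.continuous.comp cu).abs.intervalIntegrable (μ := volume)
        (2 * (bumpSeq k).rOut) (S i - 2 * (bumpSeq k).rOut)
      have ir : IntervalIntegrable (fun _ : ℝ => r) volume
        (2 * (bumpSeq k).rOut) (S i - 2 * (bumpSeq k).rOut) :=
        continuous_const.intervalIntegrable _ _
      simp only [Function.comp_def] at i1 i2 this
      rw [intervalIntegral.integral_sub i2 (i1.sub ir), intervalIntegral.integral_sub i1 ir,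
        intervalIntegral.integral_const_mul, intervalIntegral.integral_const, smul_eq_mul]
      have : S i * r / 2 ≤ (S i - 2 * (bumpSeq k).rOut - 2 * (bumpSeq k).rOut) * r := by
        nlinarith
      linarith)
  have j2 := (hint cD.continuous).const_mul 2
  have j1 := hint cF1.continuous.abs
  have jr : IntegrableOn (fun _ : Vec => r) (innerBox S k) := hint continuous_const
  have j1r : IntegrableOn (fun z => |F1 z| - r) (innerBox S k) := j1.sub jr
  rw [integral_sub j2 j1r, integral_const_mul] at hslice
  have b2 : ∫ z in innerBox S k, D z ≤ ∫ z in box S, d z := setIntegral_mollify_le hm hd hd0 _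
  have b1 : ∫ z in innerBox S k, (|mollify (bumpSeq k) (box S) g z| - r)
      = ∫ z in innerBox S k, (|F1 z| - r) :=
    setIntegral_congr_fun measurableSet_Icc fun z hz => by simp only [e1 z hz]
  linarith

lemma box_integral_abs_le (hf : IntegrableOn f (box S)) (hg : IntegrableOn g (box S))
    (hfg : IsWeakPartial (box S) i f g) (hS : 0 < S i) (hfc : ContinuousOn f (Set.Icc 0 S))
    (hf0 : ∀ z ∈ Set.Icc 0 S, z i = 0 ∨ z i = S i → f z = 0) :
    ∫ z in box S, |f z| ≤ S i * ∫ z in box S, |g z| := by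
  have hm := measurableSet_box S
  refine integral_abs_le_of_mollify hf fun r hr => ?_
  filter_upwards [eventually_rOut_lt (r := S i / 8) (by linarith),
    mollify_small_near_faces hf hfc hf0 hr] with k hk hsmall
  have hρ := (bumpSeq k).rOut_pos
  have hk4 : 2 * (bumpSeq k).rOut ≤ S i - 2 * (bumpSeq k).rOut := by linarith
  set F := mollify (bumpSeq k) (box S) f with hF
  have cF : ContDiff ℝ ∞ F := contDiff_mollify hm hf
  set F1 : Vec → ℝ := fun x => fderiv ℝ F x (e i) with hF1
  have cF1 : ContDiff ℝ ∞ F1 := contDiff_fderiv_apply cF _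
  have e1 : ∀ z ∈ innerBox S k, F1 z = mollify (bumpSeq k) (box S) g z := fun z hz =>
    (fderiv_mollify_eventuallyEq hf hfg hz).eq_of_nhds
  have hint : ∀ {G : Vec → ℝ}, Continuous G → IntegrableOn G (innerBox S k) := fun hG =>
    hG.continuousOn.integrableOn_compact isCompact_Icc
  have hslice := setIntegral_innerBox_nonneg (S := S) (k := k)
    (G := fun z => S i * |F1 z| - (|F z| - r))
    ((continuous_const.mul cF1.continuous.abs).sub (cF.continuous.abs.sub continuous_const)) i
    (by linarith)
    (fun z hz => by
      have cu : Continuous fun t => Function.update z i t := continuous_const.update i continuous_id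
      have := integral_abs_le_of_deriv (fun t => hasDerivAt_comp_update cF z i t)
        (cF1.continuous.comp cu) hk4 (hsmall _ (hz _ (Set.left_mem_Icc.2 hk4)) (by simp))
      have i2 := ((cF1.continuous.comp cu).abs.const_mul (S i)).intervalIntegrable (μ := volume)
        (2 * (bumpSeq k).rOut) (S i - 2 * (bumpSeq k).rOut)
      have i1 := (cF.continuous.comp cu).abs.intervalIntegrable (μ := volume)
        (2 * (bumpSeq k).rOut) (S i - 2 * (bumpSeq k).rOut)
      have ir : IntervalIntegrable (fun _ : ℝ => r) volume
        (2 * (bumpSeq k).rOut) (S i - 2 * (bumpSeq k).rOut) :=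
        continuous_const.intervalIntegrable _ _
      have hnn : 0 ≤ ∫ t in (2 * (bumpSeq k).rOut)..(S i - 2 * (bumpSeq k).rOut),
          |F1 (Function.update z i t)| := intervalIntegral.integral_nonneg hk4 fun _ _ => abs_nonneg _
      simp only [Function.comp_def] at i1 i2 this
      rw [intervalIntegral.integral_sub i2 (i1.sub ir), intervalIntegral.integral_sub i1 ir,
        intervalIntegral.integral_const_mul, intervalIntegral.integral_const, smul_eq_mul]
      have h2 : (S i - 2 * (bumpSeq k).rOut - 2 * (bumpSeq k).rOut) *
          (∫ t in (2 * (bumpSeq k).rOut)..(S i - 2 * (bumpSeq k).rOut),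
            |F1 (Function.update z i t)|) ≤ S i *
          ∫ t in (2 * (bumpSeq k).rOut)..(S i - 2 * (bumpSeq k).rOut),
            |F1 (Function.update z i t)| :=
        mul_le_mul_of_nonneg_right (by linarith) hnn
      rw [mul_add] at this
      linarith)
  have j2 := (hint cF1.continuous.abs).const_mul (S i)
  have j1 := hint cF.continuous.abs
  have jr : IntegrableOn (fun _ : Vec => r) (innerBox S k) := hint continuous_const
  have j1r : IntegrableOn (fun z => |F z| - r) (innerBox S k) := j1.sub jr
  rw [integral_sub j2 j1r, integral_const_mul] at hslice
  have b2 : ∫ z in innerBox S k, |F1 z| ≤ ∫ z in box S, |g z| := by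
    refine (setIntegral_congr_fun measurableSet_Icc fun z hz => ?_).trans_le
      (setIntegral_abs_mollify_le (ρ := bumpSeq k) hm hg _)
    simp only [e1 z hz]
  have := mul_le_mul_of_nonneg_left b2 hS.le
  linarith

end TwoWell

namespace TwoWell

/-! ### Weak derivatives: linear combinations, linear functions, and changes of variables -/

section WeakPartial

variable {U : Set Vec} {f g : Vec → ℝ}

lemma integrableOn_mul_of_compactSupport (hf : IntegrableOn f U) {ψ : Vec → ℝ}
    (hψ : Continuous ψ) (hc : HasCompactSupport ψ) : IntegrableOn (fun x => f x * ψ x) U := by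
  obtain ⟨C, hC⟩ := hψ.bounded_above_of_compact_support hc
  exact Integrable.mul_bdd (c := C) hf hψ.aestronglyMeasurable (Filter.Eventually.of_forall hC)

lemma integrableOn_mul_fderiv (hf : IntegrableOn f U) {ψ : Vec → ℝ} (hψ : ContDiff ℝ ∞ ψ)
    (hc : HasCompactSupport ψ) (v : Vec) : IntegrableOn (fun x => f x * fderiv ℝ ψ x v) U :=
  integrableOn_mul_of_compactSupport hf (contDiff_fderiv_apply hψ v).continuous
    (hc.fderiv_apply (𝕜 := ℝ) v)

lemma isWeakPartial_sum {ι : Type*} (s : Finset ι) (c : ι → ℝ) {f g : ι → Vec → ℝ} {j : Fin 3}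
    (hf : ∀ i ∈ s, IntegrableOn (f i) U) (hg : ∀ i ∈ s, IntegrableOn (g i) U)
    (h : ∀ i ∈ s, IsWeakPartial U j (f i) (g i)) :
    IsWeakPartial U j (fun x => ∑ i ∈ s, c i * f i x) (fun x => ∑ i ∈ s, c i * g i x) := by
  intro ψ hψ hc hs
  simp only [Finset.sum_mul, mul_assoc]
  rw [integral_finsetSum s fun i hi => (integrableOn_mul_fderiv (hf i hi) hψ hc (e j)).const_mul _,
    integral_finsetSum s fun i hi =>
      (integrableOn_mul_of_compactSupport (hg i hi) hψ.continuous hc).const_mul _,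
    ← Finset.sum_neg_distrib]
  refine Finset.sum_congr rfl fun i hi => ?_
  rw [integral_const_mul, integral_const_mul, h i hi ψ hψ hc hs, mul_neg]

lemma IsWeakPartial.sub {f₁ f₂ g₁ g₂ : Vec → ℝ} {j : Fin 3}
    (hf₁ : IntegrableOn f₁ U) (hf₂ : IntegrableOn f₂ U)
    (hg₁ : IntegrableOn g₁ U) (hg₂ : IntegrableOn g₂ U)
    (h₁ : IsWeakPartial U j f₁ g₁) (h₂ : IsWeakPartial U j f₂ g₂) :
    IsWeakPartial U j (fun x => f₁ x - f₂ x) (fun x => g₁ x - g₂ x) := by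
  intro ψ hψ hc hs
  simp only [sub_mul]
  rw [integral_sub (integrableOn_mul_fderiv hf₁ hψ hc _) (integrableOn_mul_fderiv hf₂ hψ hc _),
    integral_sub (integrableOn_mul_of_compactSupport hg₁ hψ.continuous hc)
      (integrableOn_mul_of_compactSupport hg₂ hψ.continuous hc), h₁ ψ hψ hc hs, h₂ ψ hψ hc hs]
  ring

lemma isWeakPartial_of_contDiff {l : Vec → ℝ} (hl : ContDiff ℝ ∞ l) (j : Fin 3) :
    IsWeakPartial U j l (fun x => fderiv ℝ l x (e j)) := by
  intro ψ hψ hc hs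
  have h0 : ∀ x ∉ U, ψ x = 0 := fun x hx => image_eq_zero_of_notMem_tsupport fun h => hx (hs h)
  have h1 : ∀ x ∉ U, fderiv ℝ ψ x (e j) = 0 := fun x hx => by
    rw [image_eq_zero_of_notMem_tsupport (f := fderiv ℝ ψ)
      fun h => hx (hs (tsupport_fderiv_subset ℝ h))]; rfl
  rw [setIntegral_eq_integral_of_forall_compl_eq_zero fun x hx => by rw [h1 x hx, mul_zero],
    setIntegral_eq_integral_of_forall_compl_eq_zero fun x hx => by rw [h0 x hx, mul_zero]]
  have hcd : HasCompactSupport fun x => fderiv ℝ ψ x (e j) := hc.fderiv_apply (𝕜 := ℝ) _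
  have cd := (contDiff_fderiv_apply hψ (e j)).continuous
  have := integral_mul_fderiv_eq_neg_fderiv_mul_of_integrable (μ := volume) (f := l) (g := ψ)
    (v := e j) ?_ ?_ ?_ (fun x _ => hl.differentiable (by simp) x)
    (fun x _ => hψ.differentiable (by simp) x)
  · exact this
  · exact ((contDiff_fderiv_apply hl (e j)).continuous.mul hψ.continuous).integrable_of_hasCompactSupport hc.mul_left
  · exact (hl.continuous.mul cd).integrable_of_hasCompactSupport hcd.mul_left
  · exact (hl.continuous.mul hψ.continuous).integrable_of_hasCompactSupport hc.mul_left

/-- Transport the test function by the inverse of T and apply the classical chain rule to it. No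
Jacobian appears because T preserves volume. -/
lemma isWeakPartial_comp_linear {T : Vec ≃L[ℝ] Vec} (hT : MeasurePreserving T volume volume)
    {g : Fin 3 → Vec → ℝ} (hf : IntegrableOn f U) (hg : ∀ l, IntegrableOn (g l) U)
    (h : ∀ l, IsWeakPartial U l f (g l)) (j : Fin 3) :
    IsWeakPartial (T ⁻¹' U) j (fun z => f (T z)) (fun z => ∑ l, T (e j) l * g l (T z)) := by
  intro ψ hψ hc hs
  have hemb : MeasurableEmbedding T := T.toHomeomorph.measurableEmbedding
  set φ : Vec → ℝ := fun x => ψ (T.symm x) with hφ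
  have cφ : ContDiff ℝ ∞ φ := hψ.comp T.symm.contDiff
  have hcφ : HasCompactSupport φ := hc.comp_homeomorph T.symm.toHomeomorph
  have hsφ : tsupport φ ⊆ U := by
    have : tsupport φ = T.symm ⁻¹' tsupport ψ :=
      tsupport_comp_eq_preimage ψ T.symm.toHomeomorph
    rw [this]
    intro x hx
    have := hs hx
    simpa using this
  have hder : ∀ z, fderiv ℝ ψ z (e j) = ∑ l, T (e j) l * fderiv ℝ φ (T z) (e l) := by
    intro z
    have h1 : HasFDerivAt (fun z => φ (T z)) _ z :=
      (cφ.differentiable (by simp) (T z)).hasFDerivAt.comp z T.hasFDerivAt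
    have h2 : (fun z => φ (T z)) = ψ := by ext z; simp [hφ]
    rw [h2] at h1
    rw [h1.fderiv, ContinuousLinearMap.comp_apply]
    conv_lhs => rw [ContinuousLinearEquiv.coe_coe, pi_eq_sum_univ' (T (e j))]
    simp only [map_sum, map_smul, smul_eq_mul]
    rfl
  have hψφ : ∀ z, ψ z = φ (T z) := fun z => by simp [hφ]
  have l1 := hT.setIntegral_preimage_emb hemb
    (fun x => f x * ∑ l, T (e j) l * fderiv ℝ φ x (e l)) U
  have l2 := hT.setIntegral_preimage_emb hemb (fun x => (∑ l, T (e j) l * g l x) * φ x) U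
  simp only [hder]
  simp only [hψφ]
  rw [l1, l2]
  simp only [Finset.mul_sum, Finset.sum_mul, mul_left_comm (f _), mul_assoc]
  rw [integral_finsetSum _ fun i _ => (integrableOn_mul_fderiv hf cφ hcφ (e i)).const_mul _,
    integral_finsetSum _ fun i _ =>
      (integrableOn_mul_of_compactSupport (hg i) cφ.continuous hcφ).const_mul _,
    ← Finset.sum_neg_distrib]
  refine Finset.sum_congr rfl fun i _ => ?_
  rw [integral_const_mul, integral_const_mul, h i φ cφ hcφ hsφ, mul_neg]

end WeakPartial

/-! ### The change of variables to a rectangular prism -/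

/-- The inverse of the shear `I + t e₂ ⊗ e₁`. -/
noncomputable def unshear (t : ℝ) : Vec ≃L[ℝ] Vec :=
  LinearEquiv.toContinuousLinearEquiv
    { toFun := fun z => z - (t * z 0) • e 1
      map_add' := fun x y => by simp only [Pi.add_apply]; module
      map_smul' := fun c x => by simp only [Pi.smul_apply, smul_eq_mul, RingHom.id_apply]; module
      invFun := fun z => z + (t * z 0) • e 1
      left_inv := fun z => by simp [e]
      right_inv := fun z => by simp [e] }

lemma unshear_apply (t : ℝ) (z : Vec) : unshear t z = z - (t * z 0) • e 1 := rfl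

lemma unshear_e {j : Fin 3} (t : ℝ) (hj : j ≠ 0) : unshear t (e j) = e j := by
  rw [unshear_apply]; simp [e, hj.symm]

lemma measurePreserving_unshear (t : ℝ) : MeasurePreserving (unshear t) volume volume := by
  have h := Real.volume_preserving_transvectionStruct
    (⟨1, 0, by decide, -t⟩ : Matrix.TransvectionStruct (Fin 3) ℝ)
  have heq : ⇑(unshear t) = Matrix.toLin'
      (⟨1, 0, by decide, -t⟩ : Matrix.TransvectionStruct (Fin 3) ℝ).toMatrix := by
    ext z i
    simp only [Matrix.TransvectionStruct.toMatrix, Matrix.transvection, Matrix.toLin'_apply,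
      Matrix.add_mulVec, Matrix.one_mulVec, unshear_apply, e]
    fin_cases i <;>
      simp [Matrix.mulVec, dotProduct, Matrix.single, sub_eq_add_neg]
  rw [heq]
  exact h

lemma shear_mulVec_unshear (n z : Vec) : shear n *ᵥ unshear (n 0 / n 1) z = z := by
  have h0 : ∀ i, n ⬝ᵥ e i = n i := fun i => by simp [e]
  rw [unshear_apply, shear, h0, h0, Matrix.add_mulVec, Matrix.one_mulVec, Matrix.smul_mulVec,
    Matrix.vecMulVec_mulVec]
  ext i
  fin_cases i <;> simp [e]

/-- The side lengths of the prism. -/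
def sides (L H : ℝ) : Vec := ![L, H, H]

lemma unshear_preimage_refConf (n : Vec) (L H : ℝ) :
    unshear (n 0 / n 1) ⁻¹' refConf n L H = box (sides L H) := by
  ext z
  rw [Set.mem_preimage, refConf, Set.mem_ofPred_eq, shear_mulVec_unshear]
  simp [prism, box, sides, Fin.forall_fin_succ]

lemma closure_box {S : Vec} (hS : ∀ i, 0 < S i) : closure (box S) = Set.Icc 0 S := by
  rw [box_eq_pi, closure_pi_set]
  simp only [closure_Ioo (hS _).ne]
  rw [Set.pi_univ_Icc]; rfl

lemma unshear_mem_closure_refConf {n z : Vec} {L H : ℝ} (hL : 0 < L) (hH : 0 < H)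
    (hz : z ∈ Set.Icc 0 (sides L H)) :
    unshear (n 0 / n 1) z ∈ closure (refConf n L H) := by
  have hS : ∀ i, 0 < sides L H i := by intro i; fin_cases i <;> simp [sides, hL, hH]
  rw [← closure_box hS, ← unshear_preimage_refConf n] at hz
  exact ((unshear (n 0 / n 1)).toHomeomorph.preimage_closure (refConf n L H)).symm.subset hz

lemma volume_real_box_sides {L H : ℝ} (hL : 0 < L) (hH : 0 < H) :
    volume.real (box (sides L H)) = L * H ^ 2 := by
  rw [box_eq_pi, Measure.real, Real.volume_pi_Ioo_toReal]
  · simp [Fin.prod_univ_three, sides]; ring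
  · intro i; fin_cases i <;> simp [sides, hL.le, hH.le]

end TwoWell

namespace TwoWell

/-! ### The lower bound -/

variable {A B : Mat} {a b n : Vec} {lam : ℝ}

/-- The one-sided bound on the wells extends to all matrices, since X ↦ ν·X n^⊥ is 1-Lipschitz. -/
lemma Crystallography.nu_mulVec_nPerp_sub_le (h : Crystallography A B a b n lam) (X : Mat) :
    nu b n ⬝ᵥ (X *ᵥ nPerp n) - len (macroPerp b n) ≤ distWells A B X := by
  refine le_distWells fun G hG => ?_
  have h1 : len (macroPerp b n) ≥ nu b n ⬝ᵥ (G *ᵥ nPerp n) := h.nu_dotProduct_nPerp_le hG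
  have h2 := (le_abs_self _).trans (abs_dotProduct_mulVec_le (nu b n) (nPerp n) (X - G))
  rw [h.len_nPerp, mul_one, Matrix.sub_mulVec, dotProduct_sub] at h2
  have h3 := mul_le_of_le_one_left (matNorm_nonneg (X - G)) (len_nu_le b n)
  linarith

/-- Each entry of the maximum defining c_K is 1-Lipschitz in the matrix, using α ≤ 1 for the first.
Passing from X to a well costs the distance, and the maximum is at most the sum. -/
lemma Crystallography.cK_le_add (h : Crystallography A B a b n lam) (X : Mat) :
    cK A B b n ≤ distWells A B X + alpha n * |nu b n ⬝ᵥ (X *ᵥ nPerp n) - len (macroPerp b n)|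
      + |nu b n ⬝ᵥ ((X - 1) *ᵥ e 1)| + |nu b n ⬝ᵥ ((X - 1) *ᵥ e 2)| := by
  suffices cK A B b n - alpha n * |nu b n ⬝ᵥ (X *ᵥ nPerp n) - len (macroPerp b n)|
      - |nu b n ⬝ᵥ ((X - 1) *ᵥ e 1)| - |nu b n ⬝ᵥ ((X - 1) *ᵥ e 2)| ≤ distWells A B X by linarith
  refine le_distWells fun G hG => ?_
  have hα0 := h.alpha_pos
  have hα1 := h.alpha_le_one
  have hm := matNorm_nonneg (X - G)
  have key : ∀ v : Vec, len v = 1 →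
      |nu b n ⬝ᵥ (X *ᵥ v) - nu b n ⬝ᵥ (G *ᵥ v)| ≤ matNorm (X - G) := by
    intro v hv
    have h2 := abs_dotProduct_mulVec_le (nu b n) v (X - G)
    rw [hv, mul_one, Matrix.sub_mulVec, dotProduct_sub] at h2
    exact h2.trans (mul_le_of_le_one_left hm (len_nu_le b n))
  have tri : ∀ p q r : ℝ, |p - q| ≤ matNorm (X - G) → |q - r| ≤ |p - r| + matNorm (X - G) := by
    intro p q r hpq
    calc |q - r| = |(p - r) - (p - q)| := by ring_nf
      _ ≤ |p - r| + |p - q| := abs_sub _ _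
      _ ≤ _ := by linarith
  have k0 := tri _ _ (len (macroPerp b n)) (key _ h.len_nPerp)
  have k1 := tri _ _ (nu b n ⬝ᵥ e 1) (key _ (len_e 1))
  have k2 := tri _ _ (nu b n ⬝ᵥ e 2) (key _ (len_e 2))
  have hc := cK_le b n hG
  simp only [cKFun, Matrix.sub_mulVec, Matrix.one_mulVec, dotProduct_sub] at hc ⊢
  have k0' := mul_le_mul_of_nonneg_left k0 hα0.le
  rw [mul_add] at k0'
  have k0'' := mul_le_of_le_one_left hm hα1
  have n0 : 0 ≤ alpha n * |nu b n ⬝ᵥ X *ᵥ nPerp n - len (macroPerp b n)| :=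
    mul_nonneg hα0.le (abs_nonneg _)
  have n1 := abs_nonneg (nu b n ⬝ᵥ X *ᵥ e 1 - nu b n ⬝ᵥ e 1)
  have n2 := abs_nonneg (nu b n ⬝ᵥ X *ᵥ e 2 - nu b n ⬝ᵥ e 2)
  have : max (alpha n * |nu b n ⬝ᵥ G *ᵥ nPerp n - len (macroPerp b n)|)
      (max |nu b n ⬝ᵥ G *ᵥ e 1 - nu b n ⬝ᵥ e 1| |nu b n ⬝ᵥ G *ᵥ e 2 - nu b n ⬝ᵥ e 2|)
      ≤ matNorm (X - G) + alpha n * |nu b n ⬝ᵥ X *ᵥ nPerp n - len (macroPerp b n)|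
      + |nu b n ⬝ᵥ X *ᵥ e 1 - nu b n ⬝ᵥ e 1| + |nu b n ⬝ᵥ X *ᵥ e 2 - nu b n ⬝ᵥ e 2| := by
    refine max_le (by linarith) (max_le (by linarith) (by linarith))
  linarith

/-- In prism coordinates the long edge runs along n^⊥, stretched by 1/α and with a sign depending on
n 1. -/
lemma unshear_e_zero (hn : n 1 ≠ 0) : unshear (n 0 / n 1) (e 0) = (-(n 1)⁻¹) • nPerp n := by
  rw [unshear_apply, nPerp_apply]
  ext i
  fin_cases i <;> simp [e, hn]; field_simp

lemma integrableOn_refConf_of_continuous {L H : ℝ} {f : Vec → ℝ} (hf : Continuous f) :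
    IntegrableOn f (refConf n L H) := by
  have hc : IsCompact (unshear (n 0 / n 1) '' Set.Icc 0 (sides L H)) :=
    isCompact_Icc.image (unshear (n 0 / n 1)).continuous
  refine (hf.continuousOn.integrableOn_compact hc).mono_set ?_
  have : refConf n L H = unshear (n 0 / n 1) '' box (sides L H) := by
    rw [← unshear_preimage_refConf n, Set.image_preimage_eq _ (unshear (n 0 / n 1)).surjective]
  rw [this]
  exact Set.image_mono fun z hz => ⟨fun j => (hz j).1.le, fun j => (hz j).2.le⟩

lemma integrableOn_tensorNorm {U : Set Vec} {D : Vec → Fin 3 → Fin 3 → Fin 3 → ℝ}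
    (hD : ∀ i j k, IntegrableOn (fun x => D x i j k) U) :
    IntegrableOn (fun x => tensorNorm (D x)) U := by
  have hsum : IntegrableOn (fun x => ∑ i, ∑ j, ∑ k, |D x i j k|) U :=
    integrable_finsetSum _ fun i _ => integrable_finsetSum _ fun j _ =>
      integrable_finsetSum _ fun k _ => (hD i j k).abs
  refine Integrable.mono' hsum ?_ (Filter.Eventually.of_forall fun x => ?_)
  · have hm : ∀ i j k, AEStronglyMeasurable (fun x => D x i j k) (volume.restrict U) :=
      fun i j k => (hD i j k).aestronglyMeasurable
    unfold tensorNorm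
    refine Real.continuous_sqrt.comp_aestronglyMeasurable ?_
    exact Finset.aestronglyMeasurable_fun_sum _ fun i _ =>
      Finset.aestronglyMeasurable_fun_sum _ fun j _ =>
      Finset.aestronglyMeasurable_fun_sum _ fun k _ => (hm i j k).pow 2
  · rw [Real.norm_of_nonneg (tensorNorm_nonneg _), tensorNorm]
    refine Real.sqrt_le_iff.2 ⟨by positivity, ?_⟩
    have sq_le : ∀ g : Fin 3 → ℝ, (∀ i, 0 ≤ g i) → ∑ i, g i ^ 2 ≤ (∑ i, g i) ^ 2 := fun g hg => by
      simp only [Fin.sum_univ_three]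
      nlinarith [mul_nonneg (hg 0) (hg 1), mul_nonneg (hg 0) (hg 2), mul_nonneg (hg 1) (hg 2)]
    calc ∑ i, ∑ j, ∑ k, D x i j k ^ 2 = ∑ i, ∑ j, ∑ k, |D x i j k| ^ 2 := by simp only [sq_abs]
      _ ≤ ∑ i, ∑ j, (∑ k, |D x i j k|) ^ 2 := by
          gcongr with i _ j _; exact sq_le _ fun _ => abs_nonneg _
      _ ≤ ∑ i, (∑ j, ∑ k, |D x i j k|) ^ 2 := by
          gcongr with i _; exact sq_le _ fun _ => by positivity
      _ ≤ _ := sq_le _ fun _ => by positivity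

/-- The coefficient 3 is 1 from the distance in `Crystallography.cK_le_add` plus 2 from the
derivative along n^⊥. Each of the two cross directions contributes εs + (12/ε)‖u‖₁ with ‖u‖₁ ≤
2Lδ/α, which gives 2ε and 48. -/
lemma Crystallography.cK_mul_volume_le (h : Crystallography A B a b n lam) {L H : ℝ} (hL : 0 < L)
    (hH : 0 < H) {y : Vec → Vec} {F : Vec → Mat} {D : Vec → Fin 3 → Fin 3 → Fin 3 → ℝ}
    (hy : IsW21 (refConf n L H) y F D) (hyc : ContinuousOn y (closure (refConf n L H)))
    (hy0 : ∀ x ∈ closure (refConf n L H), (x ⬝ᵥ e 0 = 0 ∨ x ⬝ᵥ e 0 = L) → y x = macro_grad b *ᵥ x)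
    (hd : IntegrableOn (fun x => distWells A B (F x)) (refConf n L H)) {ε : ℝ} (hε : 0 < ε)
    (hεH : ε < H) :
    cK A B b n * (L * H ^ 2) ≤ 3 * (∫ x in refConf n L H, distWells A B (F x))
      + 2 * ε * (∫ x in refConf n L H, tensorNorm (D x))
      + 48 * L / (ε * alpha n) * ∫ x in refConf n L H, distWells A B (F x) := by
  set U := refConf n L H with hU
  set T := unshear (n 0 / n 1) with hTdef
  set S := sides L H with hS
  have hT : MeasurePreserving T volume volume := measurePreserving_unshear _
  have hemb : MeasurableEmbedding T := T.toHomeomorph.measurableEmbedding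
  have hpre : T ⁻¹' U = box S := unshear_preimage_refConf n L H
  have hα0 := h.alpha_pos
  have hα1 := h.alpha_le_one
  have hn1 := h.n_not_collinear
  have hS0 : 0 < S 0 := hL
  -- the sign makes `T (e 0)` a positive multiple of the normalised direction
  set w : Vec := (-(n 1 / |n 1|)) • nu b n with hw
  have hsgn : |-(n 1 / |n 1|)| = 1 := by
    rw [abs_neg, abs_div, abs_abs, div_self (abs_pos.2 hn1).ne']
  have hwlen : len w ≤ 1 := by
    have : len w ^ 2 ≤ 1 := by
      rw [len_sq, hw, smul_dotProduct, dotProduct_smul, smul_eq_mul, smul_eq_mul, ← mul_assoc,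
        ← sq, ← sq_abs, hsgn, one_pow, one_mul, ← len_sq]
      exact (sq_le_one_iff₀ (len_nonneg _)).2 (len_nu_le b n)
    exact (sq_le_one_iff₀ (len_nonneg _)).1 this
  set M := macro_grad b with hM
  -- transformed deformation and its derivatives
  set f : Vec → ℝ := fun x => ∑ i, w i * y x i - w ⬝ᵥ (M *ᵥ x) with hf
  set g : Fin 3 → Vec → ℝ := fun l x => ∑ i, w i * F x i l - w ⬝ᵥ (M *ᵥ e l) with hg
  set q : Fin 3 → Fin 3 → Vec → ℝ := fun j k x => ∑ i, w i * D x i j k with hq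
  have clin : ContDiff ℝ ∞ fun x : Vec => w ⬝ᵥ (M *ᵥ x) := by
    simp only [dotProduct, Matrix.mulVec]; fun_prop
  have intf1 : IntegrableOn (fun x => ∑ i, w i * y x i) U :=
    integrable_finsetSum _ fun i _ => (hy.integrable_fun i).const_mul _
  have intg1 : ∀ l, IntegrableOn (fun x => ∑ i, w i * F x i l) U := fun l =>
    integrable_finsetSum _ fun i _ => (hy.integrable_grad i l).const_mul _
  have intf2 : IntegrableOn (fun x : Vec => w ⬝ᵥ (M *ᵥ x)) U :=
    integrableOn_refConf_of_continuous clin.continuous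
  have intc : ∀ c : ℝ, IntegrableOn (fun _ : Vec => c) U := fun c =>
    integrableOn_refConf_of_continuous continuous_const
  have intf : IntegrableOn f U := intf1.sub intf2
  have intg : ∀ l, IntegrableOn (g l) U := fun l => (intg1 l).sub (intc _)
  have intq : ∀ j k, IntegrableOn (q j k) U := fun j k =>
    integrable_finsetSum _ fun i _ => (hy.integrable_hess i j k).const_mul _
  have dlin : ∀ l x, fderiv ℝ (fun x : Vec => w ⬝ᵥ (M *ᵥ x)) x (e l) = w ⬝ᵥ (M *ᵥ e l) := by
    intro l x
    exact congrArg (fun c => c (e l)) (LinearMap.toContinuousLinearMap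
      ((dotProductBilin ℝ ℝ w).comp (Matrix.mulVecLin M))).fderiv
  have wfg : ∀ l, IsWeakPartial U l f (g l) := fun l => by
    refine IsWeakPartial.sub intf1 intf2 (intg1 l) (intc _) ?_ ?_
    · exact isWeakPartial_sum _ _ (fun i _ => hy.integrable_fun i)
        (fun i _ => hy.integrable_grad i l) fun i _ => hy.weak_grad i l
    · have := isWeakPartial_of_contDiff (U := U) clin l
      simpa only [dlin] using this
  have wgq : ∀ j k, IsWeakPartial U k (g j) (q j k) := fun j k => by
    have h1 : IsWeakPartial U k (fun _ => w ⬝ᵥ (M *ᵥ e j)) (fun _ => (0 : ℝ)) := by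
      simpa using isWeakPartial_of_contDiff (U := U) (contDiff_const (c := w ⬝ᵥ (M *ᵥ e j))) k
    have h2 := isWeakPartial_sum (U := U) Finset.univ w (fun i _ => hy.integrable_grad i j)
      (fun i _ => hy.integrable_hess i j k) fun i _ => hy.weak_hess i j k
    have := h2.sub (intg1 j) (intc _) (intq j k) (intc 0) h1
    simpa only [sub_zero] using this
  have bf : IntegrableOn (fun z => f (T z)) (box S) := by
    rw [← hpre]; exact (hT.integrableOn_comp_preimage hemb).2 intf
  have bg : ∀ l, IntegrableOn (fun z => g l (T z)) (box S) := fun l => by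
    rw [← hpre]; exact (hT.integrableOn_comp_preimage hemb).2 (intg l)
  have bq : ∀ j k, IntegrableOn (fun z => q j k (T z)) (box S) := fun j k => by
    rw [← hpre]; exact (hT.integrableOn_comp_preimage hemb).2 (intq j k)
  have bd : IntegrableOn (fun z => distWells A B (F (T z))) (box S) := by
    rw [← hpre]; exact (hT.integrableOn_comp_preimage hemb).2 hd
  have bD : IntegrableOn (fun z => tensorNorm (D (T z))) (box S) := by
    rw [← hpre]
    exact (hT.integrableOn_comp_preimage hemb).2 (integrableOn_tensorNorm hy.integrable_hess)
  have cd : ∫ z in box S, distWells A B (F (T z)) = ∫ x in U, distWells A B (F x) := by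
    rw [← hpre]; exact hT.setIntegral_preimage_emb hemb (fun x => distWells A B (F x)) U
  have cD : ∫ z in box S, tensorNorm (D (T z)) = ∫ x in U, tensorNorm (D x) := by
    rw [← hpre]; exact hT.setIntegral_preimage_emb hemb (fun x => tensorNorm (D x)) U
  set g0 : Vec → ℝ := fun z => ∑ l, T (e 0) l * g l (T z) with hg0
  have bg0 : IntegrableOn g0 (box S) := integrable_finsetSum _ fun l _ => (bg l).const_mul _
  have wt : ∀ {f : Vec → ℝ} {g : Fin 3 → Vec → ℝ}, IntegrableOn f U → (∀ l, IntegrableOn (g l) U) →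
      (∀ l, IsWeakPartial U l f (g l)) → ∀ j, IsWeakPartial (box S) j (fun z => f (T z))
        (fun z => ∑ l, T (e j) l * g l (T z)) := fun hf hg hfg j => by
    rw [← hpre]; exact isWeakPartial_comp_linear hT hf hg hfg j
  have wt' : ∀ {f : Vec → ℝ} {g : Fin 3 → Vec → ℝ}, IntegrableOn f U → (∀ l, IntegrableOn (g l) U) →
      (∀ l, IsWeakPartial U l f (g l)) → ∀ j, j ≠ 0 → IsWeakPartial (box S) j (fun z => f (T z))
        (fun z => g j (T z)) := fun hf hg hfg j hj => by
    have := wt hf hg hfg j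
    rw [unshear_e _ hj] at this
    simpa [e, Pi.single_apply] using this
  have hgdot : ∀ l x, g l x = w ⬝ᵥ ((F x - M) *ᵥ e l) := by
    intro l x
    rw [Matrix.sub_mulVec, dotProduct_sub, hg]
    simp [dotProduct, e]
  -- The sign built into w cancels the sign of n 1, so the one-sided bound keeps its direction; α⁻¹
  -- is the length of `T (e 0)`.
  have hg0val : ∀ z, g0 z = (alpha n)⁻¹ *
      (nu b n ⬝ᵥ (F (T z) *ᵥ nPerp n) - len (macroPerp b n)) := by
    intro z
    have h1 : g0 z = w ⬝ᵥ ((F (T z) - M) *ᵥ T (e 0)) := by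
      have : T (e 0) = ∑ l, T (e 0) l • e l := by
        ext i; simp [e, Pi.single_apply]
      conv_rhs => rw [this]
      simp only [hg0, hgdot, Matrix.mulVec_sum, Matrix.mulVec_smul, dotProduct_sum,
        dotProduct_smul, smul_eq_mul]
    rw [h1, hTdef, unshear_e_zero hn1, Matrix.mulVec_smul, dotProduct_smul, hw, smul_dotProduct,
      Matrix.sub_mulVec, dotProduct_sub, h.alpha_eq, ← nu_dotProduct_macroPerp, hM]
    simp only [smul_eq_mul, macroPerp]
    have := abs_pos.2 hn1
    field_simp
  have hgj : ∀ j, j ≠ 0 → ∀ x, |g j x| = |nu b n ⬝ᵥ ((F x - 1) *ᵥ e j)| := by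
    intro j hj x
    rw [hgdot, hw, smul_dotProduct, smul_eq_mul, abs_mul, hsgn, one_mul, Matrix.sub_mulVec,
      macro_grad_mulVec_e hj, Matrix.sub_mulVec, Matrix.one_mulVec]
  -- the inequalities on the box
  have hfc : ContinuousOn (fun z => f (T z)) (Set.Icc 0 S) := by
    have h1 : ContinuousOn f (closure U) := by
      refine ContinuousOn.sub ?_ clin.continuous.continuousOn
      exact continuousOn_finsetSum _ fun i _ =>
        continuousOn_const.mul ((continuous_apply i).comp_continuousOn hyc)
    exact h1.comp T.continuous.continuousOn fun z hz => unshear_mem_closure_refConf hL hH hz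
  have hf0 : ∀ z ∈ Set.Icc 0 S, z 0 = 0 ∨ z 0 = S 0 → f (T z) = 0 := by
    intro z hz hz0
    have hx : T z ⬝ᵥ e 0 = z 0 := by simp [hTdef, unshear_apply, e]
    have := hy0 (T z) (unshear_mem_closure_refConf hL hH hz) (by rw [hx]; exact hz0)
    simp only [hf, this]
    exact sub_self _
  have w0 := wt intf intg wfg 0
  have i0 : ∫ z in box S, |g0 z| ≤ 2 * ((alpha n)⁻¹ * ∫ x in U, distWells A B (F x)) := by
    have := box_integral_abs_partial_le (d := fun z => (alpha n)⁻¹ * distWells A B (F (T z)))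
      bf bg0 (bd.const_mul _) w0 hS0 hfc hf0
      (Filter.Eventually.of_forall fun z => mul_nonneg (inv_pos.2 hα0).le (distWells_nonneg _ _ _))
      (Filter.Eventually.of_forall fun z => by
        rw [hg0val]
        exact mul_le_mul_of_nonneg_left (h.nu_mulVec_nPerp_sub_le _) (inv_pos.2 hα0).le)
    rwa [integral_const_mul, cd] at this
  have iF : ∫ z in box S, |f (T z)| ≤ L * ∫ z in box S, |g0 z| :=
    box_integral_abs_le bf bg0 w0 hS0 hfc hf0
  have ij : ∀ j, j ≠ 0 → ∫ z in box S, |g j (T z)| ≤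
      ε * (∫ x in U, tensorNorm (D x)) + 12 / ε * ∫ z in box S, |f (T z)| := by
    intro j hj
    have hSj : ε < S j := by
      fin_cases j
      · exact absurd rfl hj
      · exact hεH
      · exact hεH
    have h1 := box_interpolation bf (bg j) (bq j j) (wt' intf intg wfg j hj)
      (wt' (intg j) (intq j) (wgq j) j hj) hε hSj
    have h2 : ∫ z in box S, |q j j (T z)| ≤ ∫ x in U, tensorNorm (D x) := by
      rw [← cD]
      refine setIntegral_mono (bq j j).abs bD fun z => ?_
      exact (abs_sum_mul_le_len_mul_tensorNorm w _ j j).trans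
        (mul_le_of_le_one_left (tensorNorm_nonneg _) hwlen)
    have := mul_le_mul_of_nonneg_left h2 hε.le
    linarith
  have hcV : cK A B b n * (L * H ^ 2) ≤ (∫ x in U, distWells A B (F x))
      + alpha n ^ 2 * (∫ z in box S, |g0 z|)
      + (∫ z in box S, |g 1 (T z)|) + ∫ z in box S, |g 2 (T z)| := by
    have k0 : IntegrableOn (fun z => alpha n ^ 2 * |g0 z|) (box S) := bg0.abs.const_mul _
    have k1 : IntegrableOn (fun z => |g 1 (T z)|) (box S) := (bg 1).abs
    have k2 : IntegrableOn (fun z => |g 2 (T z)|) (box S) := (bg 2).abs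
    have kd0 : IntegrableOn (fun z => distWells A B (F (T z)) + alpha n ^ 2 * |g0 z|) (box S) :=
      bd.add k0
    have kd01 : IntegrableOn (fun z => distWells A B (F (T z)) + alpha n ^ 2 * |g0 z|
      + |g 1 (T z)|) (box S) := kd0.add k1
    rw [← cd, ← integral_const_mul, ← integral_add bd k0, ← integral_add kd0 k1,
      ← integral_add kd01 k2]
    have hconst : cK A B b n * (L * H ^ 2) = ∫ _ in box S, cK A B b n := by
      rw [setIntegral_const, hS, volume_real_box_sides hL hH, smul_eq_mul, mul_comm]
    rw [hconst]
    refine setIntegral_mono (integrableOn_const (volume_box_ne_top S)) (kd01.add k2) fun z => ?_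
    have := h.cK_le_add (F (T z))
    simp only [hgj 1 (by decide), hgj 2 (by decide), hg0val, abs_mul,
      abs_of_pos (inv_pos.2 hα0)]
    -- One power of α is the weight in c_K, the other undoes the stretching in `g0`.
    have e0 : alpha n ^ 2 * ((alpha n)⁻¹ * |nu b n ⬝ᵥ F (T z) *ᵥ nPerp n - len (macroPerp b n)|)
        = alpha n * |nu b n ⬝ᵥ F (T z) *ᵥ nPerp n - len (macroPerp b n)| := by
      field_simp
    rw [e0]
    exact this
  have hDn : 0 ≤ ∫ x in U, distWells A B (F x) := integral_nonneg fun _ => distWells_nonneg _ _ _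
  set δ := ∫ x in U, distWells A B (F x)
  have m0 : alpha n ^ 2 * (∫ z in box S, |g0 z|) ≤ 2 * δ := by
    calc alpha n ^ 2 * (∫ z in box S, |g0 z|) ≤ alpha n ^ 2 * (2 * ((alpha n)⁻¹ * δ)) := by gcongr
      _ = alpha n * (2 * δ) := by field_simp
      _ ≤ 2 * δ := mul_le_of_le_one_left (by positivity) hα1
  have mF : 12 / ε * (∫ z in box S, |f (T z)|) ≤ 24 * L / (ε * alpha n) * δ := by
    calc 12 / ε * (∫ z in box S, |f (T z)|) ≤ 12 / ε * (L * (2 * ((alpha n)⁻¹ * δ))) := by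
          gcongr; exact iF.trans (by gcongr)
      _ = _ := by field_simp; ring
  have m1 := ij 1 (by decide)
  have m2 := ij 2 (by decide)
  have e48 : 48 * L / (ε * alpha n) * δ = 2 * (24 * L / (ε * alpha n) * δ) := by ring
  linarith

end TwoWell

/-! ### Optimising the length scale and passing to the energy -/

namespace TwoWell

variable {A B : Mat} {a b n : Vec} {lam : ℝ}

/-- Nonnegativity of the variance of d, after a separate case for volume zero, where the mean is
meaningless. -/
lemma sq_integral_le {U : Set Vec} (hU : volume U ≠ ⊤) {d : Vec → ℝ} (hd : IntegrableOn d U)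
    (hd2 : IntegrableOn (fun x => d x ^ 2) U) :
    (∫ x in U, d x) ^ 2 ≤ volume.real U * ∫ x in U, d x ^ 2 := by
  set V := volume.real U
  set I := ∫ x in U, d x
  rcases eq_or_lt_of_le (measureReal_nonneg : 0 ≤ V) with hV | hV
  · have h0 : volume U = 0 := by
      rcases (ENNReal.toReal_eq_zero_iff _).1 hV.symm with h | h
      exacts [h, absurd h hU]
    have hI : I = 0 := setIntegral_measure_zero _ h0
    rw [hI, zero_pow two_ne_zero]
    exact mul_nonneg measureReal_nonneg (integral_nonneg fun _ => sq_nonneg _)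
  · have h1 : 0 ≤ ∫ x in U, (d x - I / V) ^ 2 := integral_nonneg fun x => sq_nonneg _
    have h2 : ∫ x in U, (d x - I / V) ^ 2 = (∫ x in U, d x ^ 2) - 2 * (I / V) * I
        + V * (I / V) ^ 2 := by
      have c1 : IntegrableOn (fun x => 2 * (I / V) * d x) U := hd.const_mul _
      have c2 : IntegrableOn (fun _ : Vec => (I / V) ^ 2) U := integrableOn_const hU
      have c3 : IntegrableOn (fun x => d x ^ 2 - 2 * (I / V) * d x) U := hd2.sub c1
      calc ∫ x in U, (d x - I / V) ^ 2
          = ∫ x in U, (d x ^ 2 - 2 * (I / V) * d x + (I / V) ^ 2) := by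
            congr 1; ext x; ring
        _ = _ := by
            rw [integral_add c3 c2, integral_sub hd2 c1, integral_const_mul, setIntegral_const,
              smul_eq_mul]
    have h3 : (∫ x in U, d x ^ 2) - 2 * (I / V) * I + V * (I / V) ^ 2
        = (∫ x in U, d x ^ 2) - I ^ 2 / V := by field_simp; ring
    rw [h2, h3, sub_nonneg, div_le_iff₀ hV] at h1
    linarith

lemma integrable_of_lintegral_le {U : Set Vec} {f : Vec → ℝ}
    (hm : AEStronglyMeasurable f (volume.restrict U)) (hf : ∀ x, 0 ≤ f x) {I : ℝ≥0∞} (hI : I ≠ ⊤)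
    (h : ∫⁻ x in U, ENNReal.ofReal (f x) ≤ I) :
    IntegrableOn f U ∧ ∫ x in U, f x ≤ I.toReal := by
  refine ⟨⟨hm, ?_⟩, ?_⟩
  · rw [hasFiniteIntegral_iff_ofReal (Filter.Eventually.of_forall hf)]
    exact h.trans_lt hI.lt_top
  · rw [integral_eq_lintegral_of_nonneg_ae (Filter.Eventually.of_forall hf) hm]
    exact ENNReal.toReal_mono hI h

lemma volume_refConf (n : Vec) (L H : ℝ) : volume (refConf n L H) = volume (box (sides L H)) := by
  rw [← unshear_preimage_refConf n, (measurePreserving_unshear _).measure_preimage_emb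
    (unshear (n 0 / n 1)).toHomeomorph.measurableEmbedding]

/-- If E were below all three thresholds, the interpolation inequality at a suitable scale η would
bound cV by less than cV. The thresholds are arranged so that δ, Lδ and LδE are small multiples of
cV, αcHV and αc²σV² respectively. -/
lemma lower_bound_of_interpolation {c α σ L H E δ s : ℝ} (hc : 0 < c) (hα : 0 < α)
    (hσ : 0 < σ) (hL : 0 < L) (hH : 0 < H) (hδ : 0 ≤ δ)
    (hδE : δ ^ 2 ≤ L * H ^ 2 * E) (hsE : σ * s ≤ E)
    (hint : ∀ ε, 0 < ε → ε < H →
      c * (L * H ^ 2) ≤ 3 * δ + 2 * ε * s + 48 * L / (ε * α) * δ)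
    (h1 : E < 10⁻¹ ^ 6 * (c ^ 2 * (L * H ^ 2)))
    (h2 : E * L < 10⁻¹ ^ 6 * (α ^ 2 * c ^ 2 * H ^ 4))
    (h3 : E ^ 3 ≤ 10⁻¹ ^ 18 * (α ^ 2 * c ^ 4 * σ ^ 2 * L * H ^ 6)) : False := by
  set V := L * H ^ 2 with hV
  have hV0 : 0 < V := by positivity
  have hE0 : 0 ≤ E := by
    by_contra hneg
    nlinarith [sq_nonneg δ, mul_pos hV0 (neg_pos.2 (not_le.1 hneg))]
  have hδ1 : δ ≤ c * V / 1000 := by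
    refine abs_le_of_sq_le_sq' ?_ (by positivity) |>.2
    calc δ ^ 2 ≤ V * E := hδE
      _ ≤ V * (10⁻¹ ^ 6 * (c ^ 2 * V)) := by gcongr
      _ = (c * V / 1000) ^ 2 := by ring
  have hδ2 : L * δ ≤ α * c * H * V / 1000 := by
    refine abs_le_of_sq_le_sq' ?_ (by positivity) |>.2
    calc (L * δ) ^ 2 = L ^ 2 * δ ^ 2 := by ring
      _ ≤ L ^ 2 * (V * E) := by gcongr
      _ = L * V * (E * L) := by ring
      _ ≤ L * V * (10⁻¹ ^ 6 * (α ^ 2 * c ^ 2 * H ^ 4)) := by gcongr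
      _ = (α * c * H * V / 1000) ^ 2 := by rw [hV]; ring
  have hδ3 : L * δ * E ≤ α * c ^ 2 * σ * V ^ 2 / 10 ^ 9 := by
    refine abs_le_of_sq_le_sq' ?_ (by positivity) |>.2
    calc (L * δ * E) ^ 2 = L ^ 2 * E ^ 2 * δ ^ 2 := by ring
      _ ≤ L ^ 2 * E ^ 2 * (V * E) := by gcongr
      _ = L ^ 2 * V * E ^ 3 := by ring
      _ ≤ L ^ 2 * V * (10⁻¹ ^ 18 * (α ^ 2 * c ^ 4 * σ ^ 2 * L * H ^ 6)) := by gcongr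
      _ = (α * c ^ 2 * σ * V ^ 2 / 10 ^ 9) ^ 2 := by rw [hV]; ring
  have hs : s ≤ E / σ := by rw [le_div_iff₀ hσ]; linarith
  -- the length scale of the oscillations
  set η := H * (σ * c * V) / (2 * (σ * c * V) + 8 * (E * H)) with hη
  have hden : 0 < 2 * (σ * c * V) + 8 * (E * H) := by positivity
  have hη0 : 0 < η := by positivity
  have hηH : η < H := by
    rw [hη, div_lt_iff₀ hden]
    nlinarith [mul_pos hH (mul_pos (mul_pos hσ hc) hV0), mul_nonneg hE0 hH.le,
      mul_nonneg hH.le (mul_nonneg hE0 hH.le)]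
  have t2 : 2 * η * s ≤ c * V / 4 := by
    calc 2 * η * s ≤ 2 * η * (E / σ) := by gcongr
      _ ≤ c * V / 4 := by
        have e1 : 2 * η * (E / σ) = 2 * H * c * V * E / (2 * (σ * c * V) + 8 * (E * H)) := by
          rw [hη]; field_simp
        rw [e1, div_le_div_iff₀ hden (by norm_num)]
        have : 0 ≤ c * V * (2 * (σ * c * V)) := by positivity
        nlinarith
  -- The scale satisfies 1/η = 2/H + 8E/(σcV), a smooth substitute for a minimum. The two summands
  -- call for the bounds on Lδ and on LδE.
  have t3 : 48 * L / (η * α) * δ ≤ c * V / 4 := by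
    have e1 : 48 * L / (η * α) * δ
        = 96 / (H * α) * (L * δ) + 384 / (σ * c * V * α) * (L * δ * E) := by
      rw [hη]; field_simp; ring
    rw [e1]
    calc 96 / (H * α) * (L * δ) + 384 / (σ * c * V * α) * (L * δ * E)
        ≤ 96 / (H * α) * (α * c * H * V / 1000)
          + 384 / (σ * c * V * α) * (α * c ^ 2 * σ * V ^ 2 / 10 ^ 9) := by gcongr
      _ = (96 / 1000 + 384 / 10 ^ 9) * (c * V) := by field_simp
      _ ≤ c * V / 4 := by nlinarith [mul_pos hc hV0]
  have := hint η hη0 hηH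
  nlinarith [mul_pos hc hV0]

lemma rpow_cube {x : ℝ} (hx : 0 ≤ x) (m : ℕ) : (x ^ (m / 3 : ℝ)) ^ 3 = x ^ m := by
  rw [← Real.rpow_natCast, ← Real.rpow_mul hx, ← Real.rpow_natCast]
  congr 1; push_cast; ring

lemma Crystallography.le_energy (h : Crystallography A B a b n lam)
    (hNa : macroPerp b n ⬝ᵥ a ≠ 0) {φ : Mat → ℝ} (hφ : TwoWellDensity A B φ) {σ L H : ℝ}
    (hσ : 0 < σ) (hL : 0 < L) (hH : 0 < H) {y : Vec → Vec} (hya : y ∈ admissible b n L H)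
    {F : Vec → Mat} {D : Vec → Fin 3 → Fin 3 → Fin 3 → ℝ} (hy : IsW21 (refConf n L H) y F D) :
    ENNReal.ofReal (10⁻¹ ^ 6 * H ^ 3 *
      min (cKBar A B b n * (σ ^ (2 / 3 : ℝ) * L ^ (1 / 3 : ℝ) / H))
        (min (cKHat A B b n * (H / L)) (cKHat A B b n * (L / H))))
    ≤ ∫⁻ x in refConf n L H, ENNReal.ofReal (φ (F x) + σ * tensorNorm (D x)) := by
  set U := refConf n L H with hU
  set I := ∫⁻ x in U, ENNReal.ofReal (φ (F x) + σ * tensorNorm (D x)) with hI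
  rcases eq_or_ne I ⊤ with htop | hfin
  · rw [htop]; exact le_top
  have hα0 := h.alpha_pos
  have hα1 := h.alpha_le_one
  have hc : 0 < cK A B b n := (cK_pos_iff h).2 hNa
  have hvol : volume U ≠ ⊤ := by rw [hU, volume_refConf]; exact volume_box_ne_top _
  have hdm : AEStronglyMeasurable (fun x => distWells A B (F x)) (volume.restrict U) := by
    have h1 : AEMeasurable (fun x i j => F x i j : Vec → Fin 3 → Fin 3 → ℝ) (volume.restrict U) :=
      aemeasurable_pi_lambda _ fun i => aemeasurable_pi_lambda _ fun j =>
        (hy.integrable_grad i j).aemeasurable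
    have h2 : Continuous fun p : Fin 3 → Fin 3 → ℝ => distWells A B (Matrix.of p) :=
      (continuous_distWells A B).comp continuous_id
    exact (h2.measurable.comp_aemeasurable h1).aestronglyMeasurable
  have hD := integrableOn_tensorNorm hy.integrable_hess
  obtain ⟨hd2, hd2E⟩ := integrable_of_lintegral_le (hdm.pow 2) (fun x => sq_nonneg _) hfin
    (lintegral_mono fun x => ENNReal.ofReal_le_ofReal (by
      have := hφ.dist_sq_le (F x)
      have := mul_nonneg hσ.le (tensorNorm_nonneg (D x))
      simp only [Pi.pow_apply]
      linarith))
  obtain ⟨-, hDE⟩ := integrable_of_lintegral_le (hD.aestronglyMeasurable.const_mul σ)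
    (fun x => mul_nonneg hσ.le (tensorNorm_nonneg (D x))) hfin
    (lintegral_mono fun x => ENNReal.ofReal_le_ofReal (by
      have := (sq_nonneg _).trans (hφ.dist_sq_le (F x))
      linarith))
  -- On a set of finite volume d ≤ 1 + d² suffices.
  have hd : IntegrableOn (fun x => distWells A B (F x)) U := by
    refine Integrable.mono' ((integrableOn_const hvol (C := (1 : ℝ))).add hd2) hdm
      (Filter.Eventually.of_forall fun x => ?_)
    rw [Real.norm_of_nonneg (distWells_nonneg _ _ _)]
    simp only [Pi.add_apply, Pi.pow_apply]
    nlinarith [sq_nonneg (distWells A B (F x) - 1), distWells_nonneg A B (F x)]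
  have hCS := sq_integral_le hvol hd hd2
  rw [integral_const_mul] at hDE
  have hVU : volume.real U = L * H ^ 2 := by
    rw [Measure.real, hU, volume_refConf, ← Measure.real, volume_real_box_sides hL hH]
  rw [hVU] at hCS
  refine ENNReal.ofReal_le_of_le_toReal ?_
  by_contra hlt
  rw [not_le] at hlt
  have hEn : 0 ≤ I.toReal := ENNReal.toReal_nonneg
  have hk : (0 : ℝ) ≤ 10⁻¹ ^ 6 * H ^ 3 := by positivity
  have l1 := hlt.trans_le (mul_le_mul_of_nonneg_left (min_le_left _ _) hk)
  have l2 := hlt.trans_le (mul_le_mul_of_nonneg_left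
    ((min_le_right _ _).trans (min_le_left _ _)) hk)
  have l3 := hlt.trans_le (mul_le_mul_of_nonneg_left
    ((min_le_right _ _).trans (min_le_right _ _)) hk)
  have hα2 : alpha n ^ 2 ≤ 1 := pow_le_one₀ hα0.le hα1
  refine lower_bound_of_interpolation hc hα0 hσ hL hH
    (integral_nonneg fun x => distWells_nonneg A B (F x)) (hCS.trans ?_) hDE
    (fun ε hε hεH => h.cK_mul_volume_le hL hH hy hya.1 hya.2.2 hd hε hεH) ?_ ?_ ?_
  · gcongr
    exact hd2E
  · refine l3.trans_le ?_
    rw [cKHat]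
    calc 10⁻¹ ^ 6 * H ^ 3 * (alpha n ^ 2 * cK A B b n ^ 2 * (L / H))
        = alpha n ^ 2 * (10⁻¹ ^ 6 * (cK A B b n ^ 2 * (L * H ^ 2))) := by field_simp
      _ ≤ _ := mul_le_of_le_one_left (by positivity) hα2
  · have := mul_lt_mul_of_pos_right l2 hL
    refine this.trans_eq ?_
    rw [cKHat]; field_simp
  · have hle := pow_le_pow_left₀ hEn l1.le 3
    refine hle.trans ?_
    -- Cubing clears the fractional exponents. The argument needs only α² where the cube of the
    -- stated constant has α¹⁰; the remaining α⁸ is discarded by α ≤ 1.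
    have hα := rpow_cube hα0.le 10
    have hcc := rpow_cube hc.le 4
    have hs := rpow_cube hσ.le 2
    have hl := rpow_cube hL.le 1
    push_cast at hα hcc hs hl
    have e1 : (10⁻¹ ^ 6 * H ^ 3 * (cKBar A B b n * (σ ^ (2 / 3 : ℝ) * L ^ (1 / 3 : ℝ) / H))) ^ 3
        = 10⁻¹ ^ 18 * H ^ 6 * (alpha n ^ 10 * cK A B b n ^ 4 * (σ ^ 2 * L ^ 1)) := by
      rw [← hα, ← hcc, ← hs, ← hl, cKBar]; field_simp
    rw [e1]
    calc 10⁻¹ ^ 18 * H ^ 6 * (alpha n ^ 10 * cK A B b n ^ 4 * (σ ^ 2 * L ^ 1))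
        = alpha n ^ 8 * (10⁻¹ ^ 18 * (alpha n ^ 2 * cK A B b n ^ 4 * σ ^ 2 * L * H ^ 6)) := by ring
      _ ≤ _ := mul_le_of_le_one_left (by positivity) (pow_le_one₀ hα0.le hα1)

end TwoWell

theorem mainTheorem1 :
    ∃ c : ℝ, 0 < c ∧
      ∀ (A B : TwoWell.Mat) (a b n : TwoWell.Vec) (lam : ℝ),
        TwoWell.Crystallography A B a b n lam →
          IsLeast (TwoWell.cKFun b n '' TwoWell.wells A B) (TwoWell.cK A B b n) ∧
          (0 < TwoWell.cK A B b n ↔ TwoWell.macroPerp b n ⬝ᵥ a ≠ 0) ∧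
          (TwoWell.macroPerp b n ⬝ᵥ a ≠ 0 →
            ∀ (φ : TwoWell.Mat → ℝ), TwoWell.TwoWellDensity A B φ →
              ∀ σ L H : ℝ, 0 < σ → 0 < L → 0 < H →
                ENNReal.ofReal (c * H ^ 3 *
                    min (TwoWell.cKBar A B b n * (σ ^ (2 / 3 : ℝ) * L ^ (1 / 3 : ℝ) / H))
                      (min (TwoWell.cKHat A B b n * (H / L))
                        (TwoWell.cKHat A B b n * (L / H))))
                  ≤ TwoWell.minEnergy φ σ b n L H) := by
  refine ⟨10⁻¹ ^ 6, by positivity, fun A B a b n lam h =>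
    ⟨TwoWell.isLeast_cK A B b n, TwoWell.cK_pos_iff h, fun hNa φ hφ σ L H hσ hL hH => ?_⟩⟩
  exact le_iInf₂ fun y hya => le_iInf₂ fun F D => le_iInf fun hy =>
    h.le_energy hNa hφ hσ hL hH hya hy
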